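/- Let $w:\mathbb R^2\to\mathbb R$ satisfy $w\in L^1(\mathbb R^2)\cap L^2(\mathbb R^2)$ and $w(-x)=w(x)$, let $\beta>0$, and put $w_N(x)=N^{2\beta}w(N^\beta x)$ for $N\in\mathbb N$. Let $V\in L^1_{\rm loc}(\mathbb R^2;\mathbb R)$ satisfy $V(x)\ge c^{-1}|x|^s-c$ for some $s>0$, $c>0$, and let $h=-\Delta+V$ be the self-adjoint operator on $L^2(\mathbb R^2)$ associated with the closure of the quadratic form $\varphi\mapsto\int(|\nabla\varphi|^2+V|\varphi|^2)$ on $C_c^\infty(\mathbb R^2)$ (the Friedrichs extension). For $K>0$ let $\mathbf 1_{\{\sqrt h<K\}}$ denote the spectral projection $\mathbf 1_{(-\infty,K^2)}(h)$. There is a constant $C>0$, depending only on $\|w\|_{L^1}$ and $\|w\|_{L^2}$, such that the following holds. For every $\kappa>0$ there is $N_0$ (depending on $w,\beta,V,\kappa$) such that for all $N\ge N_0$ and all $K_1\ge K_2\ge\kappa$, with $P_i=\mathbf 1_{\{\sqrt h<K_i\}}$, $$P_1\otimes P_2\,w_N(x-y)\,P_1\otimes P_2\;\ge\;-C\beta K_1K_2\log(N)\,P_1\otimes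 P_2$$ on $L^2(\mathbb R^2\times\mathbb R^2)$ in the sense of quadratic forms: for every $\Psi\in L^2(\mathbb R^2\times\mathbb R^2)$ the function $w_N(x-y)\,|(P_1\otimes P_2\Psi)(x,y)|^2$ is integrable and $$\iint w_N(x-y)\,|(P_1\otimes P_2\Psi)(x,y)|^2\,dx\,dy\;\ge\;-C\beta K_1K_2\log(N)\,\langle\Psi,P_1\otimes P_2\Psi\rangle .$$ In particular, for any fixed $K_1\ge K_2>0$ the inequality holds for all $N$ large enough. -/

import Mathlib

open MeasureTheory Filter Topology
open scoped ContDiff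

noncomputable section

/-- The plane `ℝ²` with its Euclidean norm. -/
abbrev Plane : Type := EuclideanSpace ℝ (Fin 2)

/-- The one-particle space `𝔥 = L²(ℝ²; ℂ)`. -/
abbrev OneBody : Type := Lp ℂ 2 (volume : Measure Plane)

/-- The two-particle space `𝔥 ⊗ 𝔥 = L²(ℝ² × ℝ²; ℂ)` (no symmetry imposed). -/
abbrev TwoBody : Type := Lp ℂ 2 (volume : Measure (Plane × Plane))

/-- The `i`-th partial derivative of `φ`. -/
def partialD (i : Fin 2) (φ : Plane → ℂ) (x : Plane) : ℂ :=
  fderiv ℝ φ x (EuclideanSpace.single i 1)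

/-- For `V ≥ -c`, the vector `(φ, ∂₁φ, ∂₂φ, √(V + c) φ)`. The square of its `L²` norm is
`‖φ‖² + ∫ |∇φ|² + ∫ (V + c) |φ|² = ⟨φ, (-Δ + V) φ⟩ + (c + 1) ‖φ‖²`. -/
def formVector (V : Plane → ℝ) (c : ℝ) (φ : Plane → ℂ) (x : Plane) : EuclideanSpace ℂ (Fin 4) :=
  !₂[φ x, partialD 0 φ x, partialD 1 φ x, (Real.sqrt (V x + c) : ℂ) * φ x]

/-- The form domain of the Friedrichs extension of `-Δ + V` on `C_c^∞(ℝ²)`, for `V ≥ -c`: the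
completion of `C_c^∞(ℝ²)` for the norm `⟨φ, (-Δ + V) φ⟩ + (c + 1) ‖φ‖²`, realised as a
closed subspace of `L²(ℝ²; ℂ⁴)` through `formVector`. -/
def formDomain (V : Plane → ℝ) (c : ℝ) :
    Submodule ℂ (Lp (EuclideanSpace ℂ (Fin 4)) 2 (volume : Measure Plane)) :=
  (Submodule.span ℂ {ξ : Lp (EuclideanSpace ℂ (Fin 4)) 2 (volume : Measure Plane) |
    ∃ φ : Plane → ℂ, ContDiff ℝ ∞ φ ∧ HasCompactSupport φ ∧
    ξ =ᵐ[volume] formVector V c φ}).topologicalClosure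

/-- The embedding of the form domain into `L²(ℝ²)`: the first component. -/
def formEmbedding (V : Plane → ℝ) (c : ℝ) : formDomain V c →L[ℂ] OneBody :=
  (ContinuousLinearMap.compLpL 2 volume (EuclideanSpace.proj (𝕜 := ℂ) (0 : Fin 4))).comp
    (formDomain V c).subtypeL

instance formDomain_complete (V : Plane → ℝ) (c : ℝ) : CompleteSpace (formDomain V c) := by
  unfold formDomain; infer_instance

/-- The resolvent `(h + c + 1)⁻¹` of the Friedrichs extension `h = -Δ + V` (for `V ≥ -c`).
With `J` the embedding of the form domain, `u = J J* f` says exactly that `u` is in the form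
domain and that `⟨v, (h + c + 1) u⟩ = ⟨v, f⟩` in the form sense for every `v` in the form domain. -/
def hResolvent (V : Plane → ℝ) (c : ℝ) : OneBody →L[ℂ] OneBody :=
  (formEmbedding V c).comp (ContinuousLinearMap.adjoint (formEmbedding V c))

theorem isSelfAdjoint_comp_adjoint {E F : Type*} [NormedAddCommGroup E] [InnerProductSpace ℂ E]
    [CompleteSpace E] [NormedAddCommGroup F] [InnerProductSpace ℂ F] [CompleteSpace F]
    (J : E →L[ℂ] F) : IsSelfAdjoint (J.comp (ContinuousLinearMap.adjoint J)) := by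
  rw [IsSelfAdjoint, ContinuousLinearMap.star_eq_adjoint,
    ContinuousLinearMap.adjoint_comp, ContinuousLinearMap.adjoint_adjoint]

theorem hResolvent_isSelfAdjoint (V : Plane → ℝ) (c : ℝ) : IsSelfAdjoint (hResolvent V c) :=
  isSelfAdjoint_comp_adjoint (formEmbedding V c)

/-- `u = (h + c + 1)⁻¹ f` solves the weak equation `⟨v, (h + c + 1) u⟩ = ⟨v, f⟩`. -/
theorem hResolvent_weak (V : Plane → ℝ) (c : ℝ) (f : OneBody) :
    ∃ u : formDomain V c, formEmbedding V c u = hResolvent V c f ∧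
      ∀ v : formDomain V c, inner ℂ v u = inner ℂ (formEmbedding V c v) f :=
  ⟨ContinuousLinearMap.adjoint (formEmbedding V c) f, rfl,
    fun v => ContinuousLinearMap.adjoint_inner_right _ v f⟩

/-- The spectral projection `1_U(A)` of a bounded self-adjoint operator `A` for an open set `U`
of reals: the orthogonal projection onto the closed span of the ranges of all `f(A)`, where `f` is
continuous and vanishes outside `U`. -/
def spectralProjOpen {H : Type*} [NormedAddCommGroup H] [InnerProductSpace ℂ H] [CompleteSpace H]
    (A : H →L[ℂ] H) (U : Set ℝ) : H →L[ℂ] H :=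
  (Submodule.span ℂ {u : H | ∃ f : ℝ → ℝ, Continuous f ∧ (∀ t ∉ U, f t = 0) ∧
    ∃ v : H, u = cfc f A v}).topologicalClosure.starProjection

/-- The spectral projection `1_{√h < K}` of `h = -Δ + V` (for `V ≥ -c`). Spectral values `λ` of `h`
and `t` of `(h + c + 1)⁻¹` are related by `λ = t⁻¹ - (c + 1)`; as `Real.sqrt` vanishes on the
negative half-line, this is `1_{h < K²}` for `K > 0` also when `h` is not nonnegative. -/
def lowEnergyProj (V : Plane → ℝ) (c K : ℝ) : OneBody →L[ℂ] OneBody :=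
  spectralProjOpen (hResolvent V c) {t | 0 < t ∧ Real.sqrt (t⁻¹ - (c + 1)) < K}

/-- The tensor product `P ⊗ Q` on `L²(ℝ² × ℝ²)` of two orthogonal projections on `L²(ℝ²)`: the
orthogonal projection onto the closed span of all `f ⊗ g`, `f ∈ ran P`, `g ∈ ran Q`. -/
def tensorProj (P Q : OneBody →L[ℂ] OneBody) : TwoBody →L[ℂ] TwoBody :=
  (Submodule.span ℂ {Φ : TwoBody | ∃ f g : OneBody,
    Φ =ᵐ[volume] fun p => P f p.1 * Q g p.2}).topologicalClosure.starProjection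

/-- The scaled interaction `w_N = N^{2β} w(N^β ·)`. -/
def scaledPotential (w : Plane → ℝ) (β : ℝ) (N : ℕ) (x : Plane) : ℝ :=
  (N : ℝ) ^ (2 * β) * w ((N : ℝ) ^ β • x)

end

noncomputable section

open scoped ENNReal

/-! Only the size of `w_N` matters, not its sign: the form of `|w_N(x - y)|` on the range of `P₁ ⊗
P₂` is bounded from above. For almost every `x` the section in `y` of a finite sum of products lies
in the range of `P₂`, so a one-body bound `∫ |w_N(z - y)| |u(y)|² dy ≤ C β K₂² log N ‖u‖²`, uniform
in `z`, integrates to a two-body one. It passes to limits by Fatou, and `K₂² ≤ K₁ K₂` finishes.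

The one-body bound rests on a borderline Sobolev (trace) inequality, `lintegral_mul_enorm_sq_le`: `∫
ρ |φ|²` is at most `(log(1/δ) + 2) (‖ρ‖₁ + δ ‖ρ‖₂)` times the squared `L²` norm of `|φ| + |Dφ|`. At
`δ = N^{-β}` scaling gives `‖w_N‖₁ = ‖w‖₁` and `δ ‖w_N‖₂ = ‖w‖₂`, while `log(1/δ) = β log N`. On the
low-energy space the squared form norm is at most `(K² + c + 1) ‖u‖²`, which is at most `3 K² ‖u‖²`
once `K ≥ max(√c, 1)`.

For smaller `K ≥ κ` this would make the constant depend on `V` and `κ`. Compactness prevents that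
(`exists_lintegral_mul_lowEnergy_le`): since `V` is confining, the unit ball of a fixed low-energy
space is precompact in the form norm, so its elements are uniformly bounded functions plus errors
small in form norm. The bounded part costs `‖w‖₁` without a logarithm, the error a small multiple of
`β log N`; both are absorbed for large `N`. -/

/-! ### Polar coordinates and Cauchy–Schwarz -/

/-- The unit vector of the plane at angle `θ`. -/
def planeDir (θ : ℝ) : Plane := !₂[Real.cos θ, Real.sin θ]

theorem norm_planeDir (θ : ℝ) : ‖planeDir θ‖ = 1 := by
  simp [planeDir, EuclideanSpace.norm_eq]

theorem continuous_planeDir : Continuous planeDir := by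
  unfold planeDir
  fun_prop

/-- Integration over the plane in polar coordinates. -/
theorem lintegral_plane_polar (f : Plane → ℝ≥0∞) (hf : Measurable f) :
    ∫⁻ x, f x = ∫⁻ θ in Set.Ioo (-Real.pi) Real.pi, ∫⁻ r in Set.Ioi (0 : ℝ),
      ENNReal.ofReal r * f (r • planeDir θ) := by
  have e1 : ∫⁻ x, f x = ∫⁻ p : ℝ × ℝ, f (!₂[p.1, p.2]) := by
    have h1 := (PiLp.volume_preserving_toLp (Fin 2)).lintegral_comp hf
    have h2 := ((volume_preserving_finTwoArrow ℝ).symm).lintegral_comp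
      (f := fun x : Fin 2 → ℝ => f (WithLp.toLp 2 x)) (by fun_prop)
    rw [← h1, ← h2]
    rfl
  rw [e1, ← lintegral_comp_polarCoord_symm, polarCoord_target]
  have e2 : ∀ p : ℝ × ℝ, ENNReal.ofReal p.1 • f (!₂[(polarCoord.symm p).1, (polarCoord.symm p).2])
      = ENNReal.ofReal p.1 * f (p.1 • planeDir p.2) := by
    intro p
    have : (!₂[(polarCoord.symm p).1, (polarCoord.symm p).2] : Plane) = p.1 • planeDir p.2 := by
      ext i; fin_cases i <;> simp [planeDir, polarCoord]
    rw [this, smul_eq_mul]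
  simp_rw [e2]
  rw [Measure.volume_eq_prod, ← Measure.prod_restrict, lintegral_prod_symm]
  have := continuous_planeDir
  apply Measurable.aemeasurable
  exact (by fun_prop : Measurable fun p : ℝ × ℝ => ENNReal.ofReal p.1).mul
    (hf.comp (by fun_prop))

/-- The Cauchy–Schwarz inequality for lower Lebesgue integrals. -/
theorem lintegral_mul_sq_le {α : Type*} [MeasurableSpace α] {μ : Measure α} {f g : α → ℝ≥0∞}
    (hf : AEMeasurable f μ) (hg : AEMeasurable g μ) :
    (∫⁻ a, f a * g a ∂μ) ^ 2 ≤ (∫⁻ a, f a ^ 2 ∂μ) * ∫⁻ a, g a ^ 2 ∂μ := by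
  have h := ENNReal.lintegral_mul_le_Lp_mul_Lq μ Real.HolderConjugate.two_two hf hg
  calc (∫⁻ a, f a * g a ∂μ) ^ 2
      ≤ ((∫⁻ a, f a ^ (2:ℝ) ∂μ) ^ (1 / (2:ℝ)) * (∫⁻ a, g a ^ (2:ℝ) ∂μ) ^ (1 / (2:ℝ))) ^ 2 := by
        gcongr; exact h
    _ = _ := by
        rw [mul_pow, ← ENNReal.rpow_natCast, ← ENNReal.rpow_natCast, ← ENNReal.rpow_mul,
          ← ENNReal.rpow_mul]
        norm_num

/-! ### Pointwise logarithmic bound along rays -/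

/-- The function `|φ| + |Dφ|`. -/
def jetNorm (φ : Plane → ℂ) (x : Plane) : ℝ := ‖φ x‖ + ‖fderiv ℝ φ x‖

theorem jetNorm_nonneg (φ : Plane → ℂ) (x : Plane) : 0 ≤ jetNorm φ x := by
  unfold jetNorm; positivity

theorem continuous_jetNorm {φ : Plane → ℂ} (hφ : ContDiff ℝ 1 φ) : Continuous (jetNorm φ) := by
  unfold jetNorm
  exact hφ.continuous.norm.add (hφ.continuous_fderiv (by norm_num)).norm

/-- The value of a function is controlled by its jet along any ray of length one. -/
theorem norm_le_integral_jetNorm {φ : Plane → ℂ} (hφ : ContDiff ℝ 1 φ) (y : Plane) {e : Plane}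
    (he : ‖e‖ = 1) : ‖φ y‖ ≤ ∫ r in (0:ℝ)..1, jetNorm φ (y + r • e) := by
  -- The factor `1 - r` removes the endpoint `r = 1`, so the fundamental theorem of calculus leaves
  -- only the value at `y`.
  have hd : ∀ r ∈ Set.uIcc (0:ℝ) 1, HasDerivAt (fun r : ℝ => (1 - r) • φ (y + r • e))
      ((1 - r) • fderiv ℝ φ (y + r • e) e + (-1 : ℝ) • φ (y + r • e)) r := by
    intro r _
    have h1 : HasDerivAt (fun r : ℝ => y + r • e) e r := by
      simpa using ((hasDerivAt_id r).smul_const e).const_add y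
    have h2 := ((hφ.differentiable (by norm_num)) (y + r • e)).hasFDerivAt.comp_hasDerivAt r h1
    have h3 : HasDerivAt (fun r : ℝ => 1 - r) (-1) r := by
      simpa using (hasDerivAt_id r).const_sub 1
    exact h3.smul h2
  have hc1 : Continuous fun r : ℝ => fderiv ℝ φ (y + r • e) e :=
    ((hφ.continuous_fderiv (by norm_num)).comp (by fun_prop)).clm_apply continuous_const
  have hc2 : Continuous fun r : ℝ => φ (y + r • e) := hφ.continuous.comp (by fun_prop)
  have hc3 : Continuous fun r : ℝ => jetNorm φ (y + r • e) :=
    (continuous_jetNorm hφ).comp (by fun_prop)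
  have hftc := intervalIntegral.integral_eq_sub_of_hasDerivAt hd
    (Continuous.intervalIntegrable (by fun_prop) _ _)
  have e0 : ‖φ y‖ = ‖∫ r in (0:ℝ)..1, ((1 - r) • fderiv ℝ φ (y + r • e) e
      + (-1 : ℝ) • φ (y + r • e))‖ := by rw [hftc]; simp
  rw [e0]
  refine intervalIntegral.norm_integral_le_of_norm_le (by norm_num) ?_
    (hc3.intervalIntegrable _ _)
  refine ae_of_all _ fun r hr => ?_
  refine (norm_add_le _ _).trans ?_
  rw [norm_smul, norm_smul, jetNorm, add_comm]
  have h1 : ‖fderiv ℝ φ (y + r • e) e‖ ≤ ‖fderiv ℝ φ (y + r • e)‖ := by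
    simpa [he] using (fderiv ℝ φ (y + r • e)).le_opNorm e
  have h2 : ‖1 - r‖ ≤ 1 := by
    rw [Real.norm_eq_abs, abs_le]; constructor <;> linarith [hr.1, hr.2]
  have h3 : ‖(1 - r)‖ * ‖fderiv ℝ φ (y + r • e) e‖ ≤ 1 * ‖fderiv ℝ φ (y + r • e)‖ := by gcongr
  simp only [norm_neg, norm_one, one_mul] at h3 ⊢
  linarith

/-- The weight `r` alone would give a divergent integral at `0`. Below `δ` the term `√(δ r)`
dominates and contributes at most `2`; above `δ` the bound `1 / r` contributes `log(1/δ)`. -/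
theorem integral_inv_add_sqrt_le {δ : ℝ} (h0 : 0 < δ) (h1 : δ ≤ 1) :
    ∫⁻ r in Set.Ioo (0:ℝ) 1, ENNReal.ofReal (1 / (r + Real.sqrt (δ * r)))
      ≤ ENNReal.ofReal (Real.log (1 / δ) + 2) := by
  have hlog : 0 ≤ Real.log (1 / δ) := Real.log_nonneg (by rw [le_div_iff₀ h0]; linarith)
  have hsub : Set.Ioo (0:ℝ) 1 ⊆ Set.Ioc 0 δ ∪ Set.Ioc δ 1 := by
    intro r hr
    rcases le_or_gt r δ with h | h
    · exact Or.inl ⟨hr.1, h⟩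
    · exact Or.inr ⟨h, hr.2.le⟩
  have hA : ∫⁻ r in Set.Ioc (0:ℝ) δ, ENNReal.ofReal (1 / (r + Real.sqrt (δ * r)))
      ≤ ENNReal.ofReal 2 := by
    have hint : IntervalIntegrable (fun r : ℝ => (Real.sqrt δ)⁻¹ * r ^ (-(1/2) : ℝ)) volume 0 δ :=
      (intervalIntegral.intervalIntegrable_rpow' (by norm_num)).const_mul _
    have hval : ∫ r in (0:ℝ)..δ, (Real.sqrt δ)⁻¹ * r ^ (-(1/2) : ℝ) = 2 := by
      rw [intervalIntegral.integral_const_mul, integral_rpow (Or.inl (by norm_num))]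
      norm_num
      rw [← Real.sqrt_eq_rpow]
      have := (Real.sqrt_pos.2 h0).ne'
      field_simp
    calc _ ≤ ∫⁻ r in Set.Ioc (0:ℝ) δ, ENNReal.ofReal ((Real.sqrt δ)⁻¹ * r ^ (-(1/2) : ℝ)) := by
          refine setLIntegral_mono_ae' measurableSet_Ioc (ae_of_all _ fun r hr => ?_)
          apply ENNReal.ofReal_le_ofReal
          rw [Real.rpow_neg hr.1.le, ← Real.sqrt_eq_rpow, ← mul_inv, ← Real.sqrt_mul h0.le,
            one_div]
          have : 0 < Real.sqrt (δ * r) := Real.sqrt_pos.2 (mul_pos h0 hr.1)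
          gcongr
          linarith [hr.1]
      _ = ENNReal.ofReal (∫ r in Set.Ioc (0:ℝ) δ, (Real.sqrt δ)⁻¹ * r ^ (-(1/2) : ℝ)) := by
          rw [ofReal_integral_eq_lintegral_ofReal]
          · exact (intervalIntegrable_iff_integrableOn_Ioc_of_le h0.le).1 hint
          · refine (ae_restrict_iff' measurableSet_Ioc).2 (ae_of_all _ fun r hr => ?_)
            have := hr.1.le
            simp only [Pi.zero_apply]; positivity
      _ = _ := by rw [← intervalIntegral.integral_of_le h0.le, hval]
  have hB : ∫⁻ r in Set.Ioc δ 1, ENNReal.ofReal (1 / (r + Real.sqrt (δ * r)))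
      ≤ ENNReal.ofReal (Real.log (1 / δ)) := by
    have hint : IntervalIntegrable (fun r : ℝ => 1 / r) volume δ 1 := by
      apply intervalIntegral.intervalIntegrable_one_div
      · intro x hx
        rw [Set.uIcc_of_le h1] at hx
        linarith [hx.1]
      · fun_prop
    have hval : ∫ r in δ..1, 1 / r = Real.log (1 / δ) := integral_one_div_of_pos h0 one_pos
    calc _ ≤ ∫⁻ r in Set.Ioc δ 1, ENNReal.ofReal (1 / r) := by
          refine setLIntegral_mono_ae' measurableSet_Ioc (ae_of_all _ fun r hr => ?_)
          apply ENNReal.ofReal_le_ofReal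
          have : 0 < r := h0.trans hr.1
          gcongr
          linarith [Real.sqrt_nonneg (δ * r)]
      _ = ENNReal.ofReal (∫ r in Set.Ioc δ 1, 1 / r) := by
          rw [ofReal_integral_eq_lintegral_ofReal]
          · exact (intervalIntegrable_iff_integrableOn_Ioc_of_le h1).1 hint
          · refine (ae_restrict_iff' measurableSet_Ioc).2 (ae_of_all _ fun r hr => ?_)
            have : 0 < r := h0.trans hr.1
            simp only [Pi.zero_apply]; positivity
      _ = _ := by rw [← intervalIntegral.integral_of_le h1, hval]
  calc _ ≤ _ := lintegral_mono_set hsub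
    _ ≤ _ := lintegral_union_le _ _ _
    _ ≤ ENNReal.ofReal 2 + ENNReal.ofReal (Real.log (1 / δ)) := add_le_add hA hB
    _ = _ := by rw [← ENNReal.ofReal_add (by norm_num) hlog, add_comm]

/-- The radial weight `(1 + √(δ / |x|)) 1_{|x| < 1}`. -/
def radialWeight (δ : ℝ) (x : Plane) : ℝ≥0∞ :=
  (Metric.ball (0 : Plane) 1).indicator (fun x => ENNReal.ofReal (1 + Real.sqrt (δ / ‖x‖))) x

theorem measurable_radialWeight (δ : ℝ) : Measurable (radialWeight δ) := by
  unfold radialWeight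
  exact Measurable.indicator (by fun_prop) measurableSet_ball

/-- A logarithmic bound on the values of a function by weighted averages of its jet. -/
theorem enorm_sq_le_lintegral_radialWeight {φ : Plane → ℂ} (hφ : ContDiff ℝ 1 φ) {δ : ℝ}
    (h0 : 0 < δ) (h1 : δ ≤ 1) (y : Plane) :
    ENNReal.ofReal (2 * Real.pi) * ‖φ y‖ₑ ^ 2 ≤ ENNReal.ofReal (Real.log (1 / δ) + 2) *
      ∫⁻ x, radialWeight δ x * ENNReal.ofReal (jetNorm φ (y + x)) ^ 2 := by
  have hray : ∀ θ : ℝ, ‖φ y‖ₑ ^ 2 ≤ ENNReal.ofReal (Real.log (1 / δ) + 2) *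
      ∫⁻ r in Set.Ioi (0:ℝ), ENNReal.ofReal r * (radialWeight δ (r • planeDir θ) *
        ENNReal.ofReal (jetNorm φ (y + r • planeDir θ)) ^ 2) := by
    intro θ
    set e := planeDir θ
    have he : ‖e‖ = 1 := norm_planeDir θ
    have hc3 : Continuous fun r : ℝ => jetNorm φ (y + r • e) :=
      (continuous_jetNorm hφ).comp (by fun_prop)
    have hle : ‖φ y‖ₑ ≤ ∫⁻ r in Set.Ioo (0:ℝ) 1, ENNReal.ofReal (jetNorm φ (y + r • e)) := by
      rw [← ofReal_norm, ← ofReal_integral_eq_lintegral_ofReal]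
      · apply ENNReal.ofReal_le_ofReal
        rw [← integral_Ioc_eq_integral_Ioo, ← intervalIntegral.integral_of_le zero_le_one]
        exact norm_le_integral_jetNorm hφ y he
      · exact (hc3.integrableOn_Icc (a := 0) (b := 1)).mono_set Set.Ioo_subset_Icc_self
      · exact ae_of_all _ fun r => jetNorm_nonneg _ _
    -- Cauchy–Schwarz is applied with weight `r + √(δ r) = r (1 + √(δ / r))`, which is the polar
    -- density `r` times `radialWeight`.
    have hsplit : ∀ r ∈ Set.Ioo (0:ℝ) 1, ENNReal.ofReal (jetNorm φ (y + r • e)) =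
        ENNReal.ofReal (Real.sqrt (1 / (r + Real.sqrt (δ * r)))) *
        ENNReal.ofReal (Real.sqrt (r + Real.sqrt (δ * r)) * jetNorm φ (y + r • e)) := by
      intro r hr
      have hp : 0 < r + Real.sqrt (δ * r) := add_pos_of_pos_of_nonneg hr.1 (Real.sqrt_nonneg _)
      rw [← ENNReal.ofReal_mul (Real.sqrt_nonneg _), ← mul_assoc, ← Real.sqrt_mul (by positivity),
        one_div_mul_cancel hp.ne', Real.sqrt_one, one_mul]
    calc ‖φ y‖ₑ ^ 2 ≤ (∫⁻ r in Set.Ioo (0:ℝ) 1, ENNReal.ofReal (jetNorm φ (y + r • e))) ^ 2 := by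
          gcongr
      _ = (∫⁻ r in Set.Ioo (0:ℝ) 1, ENNReal.ofReal (Real.sqrt (1 / (r + Real.sqrt (δ * r)))) *
        ENNReal.ofReal (Real.sqrt (r + Real.sqrt (δ * r)) * jetNorm φ (y + r • e))) ^ 2 := by
          rw [setLIntegral_congr_fun measurableSet_Ioo hsplit]
      _ ≤ (∫⁻ r in Set.Ioo (0:ℝ) 1, ENNReal.ofReal (Real.sqrt (1 / (r + Real.sqrt (δ * r)))) ^ 2) *
          ∫⁻ r in Set.Ioo (0:ℝ) 1,
            ENNReal.ofReal (Real.sqrt (r + Real.sqrt (δ * r)) * jetNorm φ (y + r • e)) ^ 2 := by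
          apply lintegral_mul_sq_le
          · fun_prop
          · have := hc3.measurable
            fun_prop
      _ ≤ _ := by
          gcongr ?_ * ?_
          · refine le_trans (le_of_eq ?_) (integral_inv_add_sqrt_le h0 h1)
            refine setLIntegral_congr_fun measurableSet_Ioo fun r hr => ?_
            have hr0 := hr.1
            rw [← ENNReal.ofReal_pow (Real.sqrt_nonneg _), Real.sq_sqrt (by positivity)]
          · refine le_trans (setLIntegral_mono_ae' measurableSet_Ioo
              (ae_of_all _ fun r hr => le_of_eq ?_)) (lintegral_mono_set Set.Ioo_subset_Ioi_self)
            have hr0 := hr.1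
            have hn : ‖r • e‖ = r := by rw [norm_smul, he, mul_one, Real.norm_of_nonneg hr0.le]
            have hmem : r • e ∈ Metric.ball (0 : Plane) 1 := by
              rw [mem_ball_zero_iff, hn]; exact hr.2
            rw [radialWeight, Set.indicator_of_mem hmem, hn,
              ← ENNReal.ofReal_pow (jetNorm_nonneg _ _), ← ENNReal.ofReal_mul (by positivity),
              ← ENNReal.ofReal_mul hr0.le,
              ← ENNReal.ofReal_pow (mul_nonneg (Real.sqrt_nonneg _) (jetNorm_nonneg _ _)),
              mul_pow, Real.sq_sqrt (by positivity)]
            congr 1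
            have : r * Real.sqrt (δ / r) = Real.sqrt (δ * r) := by
              rw [show δ * r = r ^ 2 * (δ / r) by field_simp, Real.sqrt_mul (by positivity),
                Real.sqrt_sq hr0.le]
            rw [← this]; ring
  have hmeas : Measurable fun x => radialWeight δ x * ENNReal.ofReal (jetNorm φ (y + x)) ^ 2 := by
    have h1 := (continuous_jetNorm hφ).measurable
    have h2 := measurable_radialWeight δ
    fun_prop
  rw [lintegral_plane_polar _ hmeas]
  calc ENNReal.ofReal (2 * Real.pi) * ‖φ y‖ₑ ^ 2
      = ∫⁻ θ in Set.Ioo (-Real.pi) Real.pi, ‖φ y‖ₑ ^ 2 := by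
        rw [setLIntegral_const, Real.volume_Ioo, mul_comm]; congr 2; ring
    _ ≤ ∫⁻ θ in Set.Ioo (-Real.pi) Real.pi, _ := lintegral_mono hray
    _ = _ := by
        rw [lintegral_const_mul']
        exact ENNReal.ofReal_ne_top

/-! ### The logarithmic trace inequality for smooth functions -/

/-- The `L¹` pairing with the radial weight, controlled by the `L¹` and `L²` norms. -/
theorem lintegral_radialWeight_mul_le {δ : ℝ} (h0 : 0 < δ) {ρ : Plane → ℝ≥0∞} (hρ : Measurable ρ) :
    ∫⁻ x, radialWeight δ x * ρ x ≤ ENNReal.ofReal 2 * (∫⁻ x, ρ x) +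
      ENNReal.ofReal (Real.sqrt (2 * Real.pi) * δ) * (∫⁻ x, ρ x ^ 2) ^ (1 / 2 : ℝ) := by
  set k : Plane → ℝ≥0∞ := (Metric.ball (0 : Plane) δ).indicator
    (fun x => ENNReal.ofReal (Real.sqrt (δ / ‖x‖))) with hk
  have hkm : Measurable k := Measurable.indicator (by fun_prop) measurableSet_ball
  -- For `‖x‖ ≥ δ` the singular term is at most `1`. What remains inside radius `δ` is square
  -- integrable: in polar coordinates the density of `k ^ 2` is the constant `δ` on `(0, δ)`.
  have hpt : ∀ x, radialWeight δ x ≤ ENNReal.ofReal 2 + k x := by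
    intro x
    unfold radialWeight
    by_cases hx1 : x ∈ Metric.ball (0 : Plane) 1
    · rw [Set.indicator_of_mem hx1]
      by_cases hxd : x ∈ Metric.ball (0 : Plane) δ
      · rw [hk, Set.indicator_of_mem hxd, ← ENNReal.ofReal_add (by norm_num) (Real.sqrt_nonneg _)]
        apply ENNReal.ofReal_le_ofReal
        linarith
      · refine le_trans (ENNReal.ofReal_le_ofReal ?_) le_self_add
        have hx : δ ≤ ‖x‖ := by simpa using hxd
        have : Real.sqrt (δ / ‖x‖) ≤ 1 := by
          exact Real.sqrt_le_one.2 (div_le_one_of_le₀ hx (norm_nonneg _))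
        linarith
    · rw [Set.indicator_of_notMem hx1]; exact zero_le
  have hk2 : ∫⁻ x, k x ^ 2 = ENNReal.ofReal (2 * Real.pi * δ ^ 2) := by
    rw [lintegral_plane_polar _ (by fun_prop)]
    have : ∀ θ, ∫⁻ r in Set.Ioi (0:ℝ), ENNReal.ofReal r * k (r • planeDir θ) ^ 2
        = ENNReal.ofReal (δ ^ 2) := by
      intro θ
      have : ∀ r ∈ Set.Ioi (0:ℝ), ENNReal.ofReal r * k (r • planeDir θ) ^ 2
          = (Set.Iio δ).indicator (fun _ => ENNReal.ofReal δ) r := by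
        intro r hr
        have hr0 : 0 < r := hr
        have hn : ‖r • planeDir θ‖ = r := by
          rw [norm_smul, norm_planeDir, mul_one, Real.norm_of_nonneg hr0.le]
        by_cases hrd : r < δ
        · rw [Set.indicator_of_mem (by exact hrd), hk,
            Set.indicator_of_mem (by rwa [mem_ball_zero_iff, hn]), hn,
            ← ENNReal.ofReal_pow (Real.sqrt_nonneg _), Real.sq_sqrt (by positivity),
            ← ENNReal.ofReal_mul hr0.le]
          congr 1; field_simp
        · rw [Set.indicator_of_notMem (by exact hrd), hk,
            Set.indicator_of_notMem (by rwa [mem_ball_zero_iff, hn])]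
          simp
      rw [setLIntegral_congr_fun measurableSet_Ioi this, lintegral_indicator measurableSet_Iio,
        setLIntegral_const, Measure.restrict_apply measurableSet_Iio, Set.inter_comm,
        Set.Ioi_inter_Iio, Real.volume_Ioo, sub_zero, ← ENNReal.ofReal_mul h0.le, sq]
    simp_rw [this]
    rw [setLIntegral_const, Real.volume_Ioo, ← ENNReal.ofReal_mul (by positivity)]
    congr 1; ring
  calc ∫⁻ x, radialWeight δ x * ρ x ≤ ∫⁻ x, (ENNReal.ofReal 2 * ρ x + k x * ρ x) := by
        refine lintegral_mono fun x => ?_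
        rw [← add_mul]
        gcongr
        exact hpt x
    _ = ENNReal.ofReal 2 * (∫⁻ x, ρ x) + ∫⁻ x, k x * ρ x := by
        rw [lintegral_add_left (by fun_prop), lintegral_const_mul _ hρ]
    _ ≤ _ := by
        gcongr
        have h2 := lintegral_mul_sq_le (μ := volume) hkm.aemeasurable hρ.aemeasurable
        rw [hk2] at h2
        have h3 := ENNReal.rpow_le_rpow h2 (by norm_num : (0:ℝ) ≤ 1 / 2)
        rw [← ENNReal.rpow_natCast, ← ENNReal.rpow_mul,
          ENNReal.mul_rpow_of_nonneg _ _ (by norm_num),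
          ENNReal.ofReal_rpow_of_nonneg (by positivity) (by norm_num), ← Real.sqrt_eq_rpow,
          Real.sqrt_mul (by positivity) (δ ^ 2), Real.sqrt_sq h0.le] at h3
        simpa using h3

/-- The pointwise bound is integrated against `ρ` and the order of integration exchanged; the
convolution of `ρ` with the radial weight is then bounded uniformly. -/
theorem lintegral_mul_enorm_sq_le_of_measurable {φ : Plane → ℂ} (hφ : ContDiff ℝ 1 φ) {δ : ℝ}
    (h0 : 0 < δ) (h1 : δ ≤ 1) {ρ : Plane → ℝ≥0∞} (hρ : Measurable ρ) :
    ∫⁻ y, ρ y * ‖φ y‖ₑ ^ 2 ≤ ENNReal.ofReal (Real.log (1 / δ) + 2) *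
      ((∫⁻ x, ρ x) + ENNReal.ofReal δ * (∫⁻ x, ρ x ^ 2) ^ (1 / 2 : ℝ)) *
      ∫⁻ x, ENNReal.ofReal (jetNorm φ x) ^ 2 := by
  set L := ENNReal.ofReal (Real.log (1 / δ) + 2)
  set g : Plane → ℝ≥0∞ := fun x => ENNReal.ofReal (jetNorm φ x) ^ 2
  have hg : Measurable g := by
    have := (continuous_jetNorm hφ).measurable
    fun_prop
  have hr := measurable_radialWeight δ
  set S := (∫⁻ x, ρ x) + ENNReal.ofReal δ * (∫⁻ x, ρ x ^ 2) ^ (1 / 2 : ℝ)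
  have hpi := Real.pi_gt_three
  -- Both coefficients `2` and `√(2π)` of the weight estimate are raised to `2π`, which cancels the
  -- `2π` from averaging over directions.
  have hsq : Real.sqrt (2 * Real.pi) ≤ 2 * Real.pi := by
    rw [Real.sqrt_le_left (by positivity)]; nlinarith
  have hinner : ∀ v, ∫⁻ y, ρ y * radialWeight δ (v - y) ≤ ENNReal.ofReal (2 * Real.pi) * S := by
    intro v
    have e1 : ∫⁻ y, ρ y * radialWeight δ (v - y) = ∫⁻ x, radialWeight δ x * ρ (v - x) := by
      rw [← lintegral_sub_left_eq_self _ v]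
      simp only [sub_sub_cancel, mul_comm]
    rw [e1]
    refine (lintegral_radialWeight_mul_le h0 (ρ := fun x => ρ (v - x)) (by fun_prop)).trans ?_
    rw [lintegral_sub_left_eq_self (fun x => ρ x) v, lintegral_sub_left_eq_self (fun x => ρ x ^ 2) v,
      mul_add, ENNReal.ofReal_mul (Real.sqrt_nonneg _), mul_assoc]
    gcongr
    linarith
  have hmain : ENNReal.ofReal (2 * Real.pi) * ∫⁻ y, ρ y * ‖φ y‖ₑ ^ 2 ≤
      ENNReal.ofReal (2 * Real.pi) * (L * S * ∫⁻ x, g x) := by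
    calc ENNReal.ofReal (2 * Real.pi) * ∫⁻ y, ρ y * ‖φ y‖ₑ ^ 2
        = ∫⁻ y, ρ y * (ENNReal.ofReal (2 * Real.pi) * ‖φ y‖ₑ ^ 2) := by
          rw [← lintegral_const_mul' _ _ ENNReal.ofReal_ne_top]
          congr 1; ext y; ring
      _ ≤ ∫⁻ y, ρ y * (L * ∫⁻ x, radialWeight δ x * g (y + x)) := by
          exact lintegral_mono fun y =>
            mul_le_mul' le_rfl (enorm_sq_le_lintegral_radialWeight hφ h0 h1 y)
      _ = ∫⁻ y, L * ∫⁻ v, ρ y * radialWeight δ (v - y) * g v := by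
          congr 1; ext y
          rw [mul_left_comm, ← lintegral_add_left_eq_self (fun v => ρ y * radialWeight δ (v - y) * g v) y,
            ← lintegral_const_mul _ (by fun_prop)]
          simp only [add_sub_cancel_left, mul_assoc]
      _ = L * ∫⁻ v, ∫⁻ y, ρ y * radialWeight δ (v - y) * g v := by
          rw [lintegral_const_mul' _ _ ENNReal.ofReal_ne_top, lintegral_lintegral_swap]
          fun_prop
      _ ≤ L * ∫⁻ v, (ENNReal.ofReal (2 * Real.pi) * S) * g v := by
          gcongr with v
          rw [lintegral_mul_const _ (by fun_prop)]
          gcongr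
          exact hinner v
      _ = _ := by
          rw [lintegral_const_mul _ hg]; ring
  exact (ENNReal.mul_le_mul_iff_right (by simp [Real.pi_pos]) ENNReal.ofReal_ne_top).1 hmain

/-- A logarithmic trace inequality in the plane: a potential `ρ` is form bounded by the Sobolev
norm with a constant that involves its `L²` norm only at the scale `δ`. -/
theorem lintegral_mul_enorm_sq_le {φ : Plane → ℂ} (hφ : ContDiff ℝ 1 φ) {δ : ℝ}
    (h0 : 0 < δ) (h1 : δ ≤ 1) {ρ : Plane → ℝ≥0∞} (hρ : AEMeasurable ρ) :
    ∫⁻ y, ρ y * ‖φ y‖ₑ ^ 2 ≤ ENNReal.ofReal (Real.log (1 / δ) + 2) *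
      ((∫⁻ x, ρ x) + ENNReal.ofReal δ * (∫⁻ x, ρ x ^ 2) ^ (1 / 2 : ℝ)) *
      ∫⁻ x, ENNReal.ofReal (jetNorm φ x) ^ 2 := by
  have h := lintegral_mul_enorm_sq_le_of_measurable hφ h0 h1 hρ.measurable_mk
  have e := hρ.ae_eq_mk
  rw [lintegral_congr_ae e, lintegral_congr_ae (e.mono fun x hx => by simp only [hx] :
      (fun x => ρ x ^ 2) =ᵐ[volume] fun x => hρ.mk ρ x ^ 2),
    lintegral_congr_ae (e.mono fun x hx => by simp only [hx] :
      (fun y => ρ y * ‖φ y‖ₑ ^ 2) =ᵐ[volume] fun y => hρ.mk ρ y * ‖φ y‖ₑ ^ 2)]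
  exact h

/-! ### Extension to the form domain by density and Fatou -/

/-- Fatou's lemma for a weighted `L²` integral along an `L²`-convergent sequence. -/
theorem lintegral_mul_enorm_sq_le_of_tendsto {α E : Type*} [MeasurableSpace α] {μ : Measure α}
    [NormedAddCommGroup E] {ρ : α → ℝ≥0∞} (hρ : AEMeasurable ρ μ) {u : ℕ → Lp E 2 μ} {v : Lp E 2 μ}
    (hu : Tendsto u atTop (𝓝 v)) {m : ℕ → ℝ≥0∞} {M : ℝ≥0∞} (hm : Tendsto m atTop (𝓝 M))
    (h : ∀ n, ∫⁻ x, ρ x * ‖u n x‖ₑ ^ 2 ∂μ ≤ m n) : ∫⁻ x, ρ x * ‖v x‖ₑ ^ 2 ∂μ ≤ M := by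
  obtain ⟨ns, hns, hae⟩ := (tendstoInMeasure_of_tendsto_Lp hu).exists_seq_tendsto_ae
  have hlim : ∀ᵐ x ∂μ, ρ x * ‖v x‖ₑ ^ 2 ≤ liminf (fun n => ρ x * ‖u (ns n) x‖ₑ ^ 2) atTop := by
    filter_upwards [hae] with x hx
    have h1 : Tendsto (fun n => ‖u (ns n) x‖ₑ ^ 2) atTop (𝓝 (‖v x‖ₑ ^ 2)) :=
      ENNReal.Tendsto.pow hx.enorm
    calc ρ x * ‖v x‖ₑ ^ 2 = ρ x * liminf (fun n => ‖u (ns n) x‖ₑ ^ 2) atTop := by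
          rw [h1.liminf_eq]
      _ ≤ liminf (fun _ : ℕ => ρ x) atTop * liminf (fun n => ‖u (ns n) x‖ₑ ^ 2) atTop := by
          rw [liminf_const]
      _ ≤ _ := ENNReal.le_liminf_mul
  calc ∫⁻ x, ρ x * ‖v x‖ₑ ^ 2 ∂μ
      ≤ ∫⁻ x, liminf (fun n => ρ x * ‖u (ns n) x‖ₑ ^ 2) atTop ∂μ := lintegral_mono_ae hlim
    _ ≤ liminf (fun n => ∫⁻ x, ρ x * ‖u (ns n) x‖ₑ ^ 2 ∂μ) atTop :=
        lintegral_liminf_le' fun n =>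
          hρ.mul ((Lp.aestronglyMeasurable _).enorm.pow_const 2)
    _ ≤ liminf (fun n => m (ns n)) atTop := liminf_le_liminf (Eventually.of_forall fun n => h _)
    _ = M := (hm.comp hns.tendsto_atTop).liminf_eq

theorem lintegral_enorm_sq_eq_enorm_sq {α E : Type*} [MeasurableSpace α] {μ : Measure α}
    [NormedAddCommGroup E] (u : Lp E 2 μ) : ∫⁻ x, ‖u x‖ₑ ^ 2 ∂μ = ‖u‖ₑ ^ 2 := by
  have h := eLpNorm_nnreal_pow_eq_lintegral (f := u) (μ := μ) (p := 2) (by norm_num)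
  rw [Lp.enorm_def]
  simpa using h.symm

theorem partialD_add {φ ψ : Plane → ℂ} (hφ : Differentiable ℝ φ) (hψ : Differentiable ℝ ψ)
    (i : Fin 2) (x : Plane) : partialD i (φ + ψ) x = partialD i φ x + partialD i ψ x := by
  simp [partialD, fderiv_add (hφ x) (hψ x)]

theorem partialD_smul {φ : Plane → ℂ} (hφ : Differentiable ℝ φ) (a : ℂ)
    (i : Fin 2) (x : Plane) : partialD i (a • φ) x = a * partialD i φ x := by
  simp [partialD, fderiv_const_smul (hφ x)]

theorem formVector_add (V : Plane → ℝ) (c : ℝ) {φ ψ : Plane → ℂ} (hφ : Differentiable ℝ φ)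
    (hψ : Differentiable ℝ ψ) (x : Plane) :
    formVector V c (φ + ψ) x = formVector V c φ x + formVector V c ψ x := by
  ext i
  fin_cases i <;> simp [formVector, partialD_add hφ hψ, mul_add]

theorem formVector_smul (V : Plane → ℝ) (c : ℝ) {φ : Plane → ℂ} (hφ : Differentiable ℝ φ)
    (a : ℂ) (x : Plane) : formVector V c (a • φ) x = a • formVector V c φ x := by
  ext i
  fin_cases i <;> simp [formVector, partialD_smul hφ, mul_left_comm]

theorem formVector_zero (V : Plane → ℝ) (c : ℝ) (x : Plane) :
    formVector V c (0 : Plane → ℂ) x = 0 := by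
  ext i
  fin_cases i <;> simp [formVector, partialD]

/-- The space of the vectors `formVector V c φ` for `φ` smooth with compact support. -/
def smoothForms (V : Plane → ℝ) (c : ℝ) :
    Submodule ℂ (Lp (EuclideanSpace ℂ (Fin 4)) 2 (volume : Measure Plane)) where
  carrier := {ξ | ∃ φ : Plane → ℂ, ContDiff ℝ ∞ φ ∧ HasCompactSupport φ ∧
    ξ =ᵐ[volume] formVector V c φ}
  zero_mem' := ⟨0, contDiff_const, HasCompactSupport.zero, by
    filter_upwards [Lp.coeFn_zero (EuclideanSpace ℂ (Fin 4)) 2 (volume : Measure Plane)] with x hx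
    rw [hx, formVector_zero]; rfl⟩
  add_mem' := by
    rintro ξ η ⟨φ, h1, h2, h3⟩ ⟨ψ, h4, h5, h6⟩
    refine ⟨φ + ψ, h1.add h4, h2.add h5, ?_⟩
    filter_upwards [Lp.coeFn_add ξ η, h3, h6] with x hx hx1 hx2
    rw [hx, Pi.add_apply, hx1, hx2, formVector_add V c (h1.differentiable (by simp))
      (h4.differentiable (by simp))]
  smul_mem' := by
    rintro a ξ ⟨φ, h1, h2, h3⟩
    refine ⟨a • φ, h1.const_smul a, h2.smul_left (f := fun _ => a), ?_⟩
    filter_upwards [Lp.coeFn_smul a ξ, h3] with x hx hx1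
    rw [hx, Pi.smul_apply, hx1, formVector_smul V c (h1.differentiable (by simp))]

/-- The generating set is already a subspace, so the span can be dropped and every element is a
limit of vectors coming from single test functions. -/
theorem formDomain_eq_closure (V : Plane → ℝ) (c : ℝ) :
    formDomain V c = (smoothForms V c).topologicalClosure := by
  have : Submodule.span ℂ {ξ : Lp (EuclideanSpace ℂ (Fin 4)) 2 (volume : Measure Plane) |
    ∃ φ : Plane → ℂ, ContDiff ℝ ∞ φ ∧ HasCompactSupport φ ∧
    ξ =ᵐ[volume] formVector V c φ} = smoothForms V c := Submodule.span_eq (smoothForms V c)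
  rw [formDomain, this]

/-- Elements of the form domain are limits of smooth ones. -/
theorem exists_seq_smoothForms {V : Plane → ℝ} {c : ℝ} (ξ : formDomain V c) :
    ∃ η : ℕ → formDomain V c, (∀ n, (η n : Lp (EuclideanSpace ℂ (Fin 4)) 2 (volume : Measure Plane))
      ∈ smoothForms V c) ∧ Tendsto η atTop (𝓝 ξ) := by
  have h := (formDomain_eq_closure V c).le ξ.2
  obtain ⟨η, h1, h2⟩ := mem_closure_iff_seq_limit.1 h
  have hle : ∀ n, η n ∈ formDomain V c := fun n => by
    rw [formDomain_eq_closure]; exact subset_closure (h1 n)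
  exact ⟨fun n => ⟨η n, hle n⟩, h1, tendsto_subtype_rng.2 h2⟩

theorem coeFn_formEmbedding {V : Plane → ℝ} {c : ℝ} (ξ : formDomain V c) :
    formEmbedding V c ξ =ᵐ[volume]
      fun x => (ξ : Lp (EuclideanSpace ℂ (Fin 4)) 2 (volume : Measure Plane)) x 0 :=
  ContinuousLinearMap.coeFn_compLpL _ _

theorem norm_fderiv_sq_le (φ : Plane → ℂ) (x : Plane) :
    ‖fderiv ℝ φ x‖ ^ 2 ≤ ‖partialD 0 φ x‖ ^ 2 + ‖partialD 1 φ x‖ ^ 2 := by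
  set a := ‖partialD 0 φ x‖
  set b := ‖partialD 1 φ x‖
  have h : ‖fderiv ℝ φ x‖ ≤ Real.sqrt (a ^ 2 + b ^ 2) := by
    refine ContinuousLinearMap.opNorm_le_bound _ (Real.sqrt_nonneg _) fun v => ?_
    have hv : v = v 0 • EuclideanSpace.single 0 1 + v 1 • EuclideanSpace.single 1 1 := by
      ext i; fin_cases i <;> simp
    have e1 : fderiv ℝ φ x v = v 0 • partialD 0 φ x + v 1 • partialD 1 φ x := by
      conv_lhs => rw [hv]
      rw [map_add, map_smul, map_smul]; rfl
    rw [e1, EuclideanSpace.norm_eq, Fin.sum_univ_two, ← Real.sqrt_mul (by positivity)]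
    refine (norm_add_le _ _).trans (Real.le_sqrt_of_sq_le ?_)
    rw [norm_smul, norm_smul]
    nlinarith [sq_nonneg (‖v 0‖ * b - ‖v 1‖ * a)]
  calc _ ≤ Real.sqrt (a ^ 2 + b ^ 2) ^ 2 := by gcongr
    _ = _ := Real.sq_sqrt (by positivity)

theorem norm_formVector_sq (V : Plane → ℝ) (c : ℝ) (φ : Plane → ℂ) (x : Plane) :
    ‖formVector V c φ x‖ ^ 2 = ‖φ x‖ ^ 2 + ‖partialD 0 φ x‖ ^ 2 + ‖partialD 1 φ x‖ ^ 2 +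
      Real.sqrt (V x + c) ^ 2 * ‖φ x‖ ^ 2 := by
  rw [EuclideanSpace.norm_sq_eq, Fin.sum_univ_four]
  simp [formVector, mul_pow]

theorem jetNorm_sq_le_formVector (V : Plane → ℝ) (c : ℝ) (φ : Plane → ℂ) (x : Plane) :
    jetNorm φ x ^ 2 ≤ 2 * ‖formVector V c φ x‖ ^ 2 := by
  rw [norm_formVector_sq, jetNorm]
  have h1 := norm_fderiv_sq_le φ x
  have h2 : 0 ≤ Real.sqrt (V x + c) ^ 2 * ‖φ x‖ ^ 2 := by positivity
  nlinarith [sq_nonneg (‖φ x‖ - ‖fderiv ℝ φ x‖)]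

/-- The logarithmic trace inequality on the form domain. -/
theorem lintegral_mul_formEmbedding_le {V : Plane → ℝ} {c : ℝ} {δ : ℝ}
    (h0 : 0 < δ) (h1 : δ ≤ 1) {ρ : Plane → ℝ≥0∞} (hρ : AEMeasurable ρ)
    {S : ℝ≥0∞} (hS : (∫⁻ x, ρ x) + ENNReal.ofReal δ * (∫⁻ x, ρ x ^ 2) ^ (1 / 2 : ℝ) ≤ S)
    (hS' : S ≠ ⊤) (ξ : formDomain V c) :
    ∫⁻ y, ρ y * ‖formEmbedding V c ξ y‖ₑ ^ 2 ≤
      ENNReal.ofReal (2 * (Real.log (1 / δ) + 2)) * S * ‖ξ‖ₑ ^ 2 := by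
  obtain ⟨η, hη, hlim⟩ := exists_seq_smoothForms ξ
  refine lintegral_mul_enorm_sq_le_of_tendsto hρ
    (((formEmbedding V c).continuous.tendsto ξ).comp hlim)
    (m := fun n => ENNReal.ofReal (2 * (Real.log (1 / δ) + 2)) * S * ‖η n‖ₑ ^ 2) ?_ fun n => ?_
  · refine ENNReal.Tendsto.const_mul (ENNReal.Tendsto.pow hlim.enorm) (Or.inr ?_)
    exact ENNReal.mul_ne_top ENNReal.ofReal_ne_top hS'
  · obtain ⟨φ, hφ, -, hae⟩ := hη n
    have e1 : ∫⁻ y, ρ y * ‖formEmbedding V c (η n) y‖ₑ ^ 2 = ∫⁻ y, ρ y * ‖φ y‖ₑ ^ 2 := by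
      refine lintegral_congr_ae ?_
      filter_upwards [coeFn_formEmbedding (η n), hae] with x hx hx1
      rw [hx, hx1]; rfl
    have e2 : ∫⁻ x, ENNReal.ofReal (jetNorm φ x) ^ 2 ≤ ENNReal.ofReal 2 * ‖η n‖ₑ ^ 2 := by
      have e3 : ‖η n‖ₑ ^ 2 = ∫⁻ x, ‖formVector V c φ x‖ₑ ^ 2 := by
        rw [show ‖η n‖ₑ = ‖(η n : Lp (EuclideanSpace ℂ (Fin 4)) 2 (volume : Measure Plane))‖ₑ from rfl,
          ← lintegral_enorm_sq_eq_enorm_sq]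
        exact lintegral_congr_ae (hae.mono fun x hx => by simp only [hx])
      rw [e3, ← lintegral_const_mul' _ _ ENNReal.ofReal_ne_top]
      refine lintegral_mono fun x => ?_
      rw [← ofReal_norm, ← ENNReal.ofReal_pow (jetNorm_nonneg _ _),
        ← ENNReal.ofReal_pow (norm_nonneg _), ← ENNReal.ofReal_mul (by norm_num)]
      exact ENNReal.ofReal_le_ofReal (jetNorm_sq_le_formVector V c φ x)
    simp only [Function.comp_apply]
    rw [e1]
    refine (lintegral_mul_enorm_sq_le (hφ.of_le (by simp)) h0 h1 hρ).trans ?_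
    rw [mul_comm 2, ENNReal.ofReal_mul' (by norm_num)]
    calc _ ≤ ENNReal.ofReal (Real.log (1 / δ) + 2) * S * (ENNReal.ofReal 2 * ‖η n‖ₑ ^ 2) := by
          gcongr
      _ = _ := by ring

/-! ### Spectral subspaces of `J J*` -/

section Spectral

variable {H : Type*} [NormedAddCommGroup H] [InnerProductSpace ℂ H] [CompleteSpace H]

/-- The range of the spectral projection `1_U(A)`. -/
def spectralSpaceOpen (A : H →L[ℂ] H) (U : Set ℝ) : Submodule ℂ H :=
  (Submodule.span ℂ {u : H | ∃ f : ℝ → ℝ, Continuous f ∧ (∀ t ∉ U, f t = 0) ∧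
    ∃ v : H, u = cfc f A v}).topologicalClosure

theorem spectralProjOpen_mem (A : H →L[ℂ] H) (U : Set ℝ) (u : H) :
    spectralProjOpen A U u ∈ spectralSpaceOpen A U := by
  unfold spectralProjOpen spectralSpaceOpen
  exact Submodule.starProjection_apply_mem _ _

theorem spectralSpaceOpen_mono (A : H →L[ℂ] H) {U U' : Set ℝ} (h : U ⊆ U') :
    spectralSpaceOpen A U ≤ spectralSpaceOpen A U' := by
  refine Submodule.topologicalClosure_mono (Submodule.span_mono ?_)
  rintro u ⟨f, hf, hf0, hv⟩
  exact ⟨f, hf, fun t ht => hf0 t fun ht' => ht (h ht'), hv⟩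

/-- A self-adjoint operator is boundedly invertible on its spectral subspaces away from zero. -/
theorem exists_inverse_spectralSpaceOpen {R : H →L[ℂ] H} (hR : IsSelfAdjoint R) {s : ℝ}
    (hs : 0 < s) {U : Set ℝ} (hU : ∀ t ∈ U, s⁻¹ ≤ t) :
    ∃ B : H →L[ℂ] H, ‖B‖ ≤ s ∧ ∀ u ∈ spectralSpaceOpen R U, R (B u) = u := by
  -- Truncation makes the inverse continuous and bounded by `s` on all of `ℝ` without changing it on
  -- `U`, so `t * g t * f t = f t` whenever `f` vanishes off `U`.
  set g : ℝ → ℝ := fun t => (max t s⁻¹)⁻¹ with hg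
  have hmax : ∀ t : ℝ, 0 < max t s⁻¹ := fun t => lt_max_of_lt_right (inv_pos.2 hs)
  have hgc : Continuous g := by
    rw [hg]
    exact Continuous.inv₀ (by fun_prop) fun t => (hmax t).ne'
  have hB : ‖cfc g R‖ ≤ s := by
    refine norm_cfc_le hs.le fun t _ => ?_
    rw [Real.norm_of_nonneg (inv_nonneg.2 (hmax t).le)]
    exact inv_le_of_inv_le₀ hs (le_max_right _ _)
  refine ⟨cfc g R, hB, fun u hu => ?_⟩
  have hclosed : IsClosed {u : H | R (cfc g R u) = u} :=
    isClosed_eq (R.continuous.comp (cfc g R).continuous) continuous_id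
  refine (closure_minimal ?_ hclosed) hu
  intro u hu
  refine Submodule.span_induction (p := fun u _ => R (cfc g R u) = u) ?_ (by simp)
    (fun x y _ _ hx hy => by rw [map_add, map_add, hx, hy])
    (fun a x _ hx => by rw [map_smul, map_smul, hx]) hu
  rintro u ⟨f, hf, hf0, v, rfl⟩
  have e1 : R * cfc g R = cfc (fun t => t * g t) R := by
    rw [cfc_mul (fun t => t) g R continuousOn_id hgc.continuousOn, cfc_id' ℝ R hR]
  have e : R * cfc g R * cfc f R = cfc f R := by
    rw [e1, ← cfc_mul (fun t => t * g t) f R (continuous_id.mul hgc).continuousOn hf.continuousOn]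
    congr 1
    ext t
    by_cases ht : t ∈ U
    · have h2 := hU t ht
      simp only [hg, max_eq_left h2]
      rw [mul_inv_cancel₀ ((inv_pos.2 hs).trans_le h2).ne', one_mul]
    · rw [hf0 t ht, mul_zero]
  exact congrArg (fun T : H →L[ℂ] H => T v) e

/-- Spectral subspaces of `J J*` away from zero lift through `J`. -/
theorem exists_lift_spectralSpaceOpen {E : Type*} [NormedAddCommGroup E] [InnerProductSpace ℂ E]
    [CompleteSpace E] (J : E →L[ℂ] H) {s : ℝ} (hs : 0 < s) {U : Set ℝ}
    (hU : ∀ t ∈ U, s⁻¹ ≤ t) :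
    ∃ L : H →L[ℂ] E, ∀ u ∈ spectralSpaceOpen (J.comp (ContinuousLinearMap.adjoint J)) U,
      J (L u) = u ∧ ‖L u‖ ^ 2 ≤ s * ‖u‖ ^ 2 := by
  obtain ⟨B, hB, hRB⟩ := exists_inverse_spectralSpaceOpen (isSelfAdjoint_comp_adjoint J) hs hU
  -- The lift is `J* B u`. Its squared norm is `⟨B u, J J* B u⟩ = ⟨B u, u⟩`, so the bound on `B`
  -- enters only once.
  refine ⟨(ContinuousLinearMap.adjoint J).comp B, fun u hu => ⟨hRB u hu, ?_⟩⟩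
  have e0 : J (ContinuousLinearMap.adjoint J (B u)) = u := hRB u hu
  have e1 : ‖ContinuousLinearMap.adjoint J (B u)‖ ^ 2 = RCLike.re (inner ℂ (B u) u) := by
    rw [← inner_self_eq_norm_sq (𝕜 := ℂ), ContinuousLinearMap.adjoint_inner_left, e0]
  rw [ContinuousLinearMap.comp_apply, e1]
  calc RCLike.re (inner ℂ (B u) u) ≤ ‖B u‖ * ‖u‖ := re_inner_le_norm _ _
    _ ≤ (s * ‖u‖) * ‖u‖ := by
        gcongr
        exact B.le_of_opNorm_le hB u
    _ = _ := by ring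

end Spectral

/-! ### Low-energy spaces -/

/-- The range of the spectral projection `1_{√h < K}`. -/
def lowEnergySpace (V : Plane → ℝ) (c K : ℝ) : Submodule ℂ OneBody :=
  spectralSpaceOpen (hResolvent V c) {t | 0 < t ∧ Real.sqrt (t⁻¹ - (c + 1)) < K}

theorem lowEnergyProj_mem (V : Plane → ℝ) (c K : ℝ) (u : OneBody) :
    lowEnergyProj V c K u ∈ lowEnergySpace V c K :=
  spectralProjOpen_mem _ _ u

theorem lowEnergySpace_mono (V : Plane → ℝ) (c : ℝ) {K K' : ℝ} (h : K ≤ K') :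
    lowEnergySpace V c K ≤ lowEnergySpace V c K' :=
  spectralSpaceOpen_mono _ fun _ ht => ⟨ht.1, ht.2.trans_le h⟩

/-- Low-energy vectors lie in the form domain, and `⟨u, h u⟩ ≤ K² ‖u‖²` on them. -/
theorem exists_formDomain_lift (V : Plane → ℝ) {c K : ℝ} (hc : 0 < c) (hK : 0 < K) :
    ∃ L : OneBody →L[ℂ] formDomain V c, ∀ u ∈ lowEnergySpace V c K,
      formEmbedding V c (L u) = u ∧ ‖L u‖ ^ 2 ≤ (K ^ 2 + c + 1) * ‖u‖ ^ 2 := by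
  refine exists_lift_spectralSpaceOpen (formEmbedding V c) (by positivity) ?_
  rintro t ⟨ht0, ht1⟩
  have h1 : t⁻¹ - (c + 1) < K ^ 2 := (Real.sqrt_lt' hK).1 ht1
  exact inv_le_of_inv_le₀ ht0 (by linarith)

/-! ### Compactness of the form embedding -/

/-- A bounded operator that is controlled, up to arbitrarily small errors, by operators of finite
rank maps balls to totally bounded sets. -/
theorem totallyBounded_image_closedBall {X Y : Type*} [NormedAddCommGroup X] [NormedSpace ℂ X]
    [NormedAddCommGroup Y] [NormedSpace ℂ Y] (J : X →L[ℂ] Y)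
    (h : ∀ ε : ℝ, 0 < ε → ∃ (t : Finset Plane) (A : X →L[ℂ] (t → ℂ)) (C : ℝ), 0 ≤ C ∧
      ∀ x, ‖J x‖ ^ 2 ≤ ε * ‖x‖ ^ 2 + C * ‖A x‖ ^ 2) (r : ℝ) :
    TotallyBounded (J '' Metric.closedBall 0 r) := by
  rw [Metric.totallyBounded_iff]
  intro ε hε
  -- Two points of the ball differ by at most `2 r`, so this term and the finite-rank term (net of
  -- mesh `δ`) each contribute at most `ε ^ 2 / 4`.
  obtain ⟨t, A, C, hC, hA⟩ := h (ε ^ 2 / (16 * (r ^ 2 + 1))) (by positivity)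
  have hb : TotallyBounded (A '' Metric.closedBall 0 r) :=
    (((A.lipschitz.isBounded_image Metric.isBounded_closedBall).subset
      subset_rfl).isCompact_closure.totallyBounded).subset subset_closure
  set δ := ε / (2 * Real.sqrt (C + 1)) with hδ
  have hδ0 : 0 < δ := by positivity
  obtain ⟨T, hTs, hTf, hT⟩ := Metric.finite_approx_of_totallyBounded hb δ hδ0
  obtain ⟨S, hS, rfl⟩ := Set.subset_image_iff.1 hTs
  obtain ⟨S', hS', hS'f, hSS'⟩ : ∃ S' ⊆ S, S'.Finite ∧ A '' S' = A '' S := by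
    obtain ⟨S', h1, h2⟩ := Set.exists_subset_bijOn S A
    exact ⟨S', h1, h2.finite_iff_finite.2 hTf, h2.image_eq⟩
  refine ⟨J '' S', hS'f.image _, ?_⟩
  rintro _ ⟨x, hx, rfl⟩
  obtain ⟨w, hw, hxw⟩ := Set.mem_iUnion₂.1 (hT ⟨x, hx, rfl⟩)
  rw [← hSS'] at hw
  obtain ⟨y, hy, rfl⟩ := hw
  refine Set.mem_iUnion₂.2 ⟨J y, ⟨y, hy, rfl⟩, ?_⟩
  have hxr : ‖x‖ ≤ r := by simpa using hx
  have hyr : ‖y‖ ≤ r := by simpa using hS (hS' hy)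
  rw [Metric.mem_ball, dist_eq_norm, ← map_sub] at hxw ⊢
  have h1 : ‖x - y‖ ≤ 2 * r := (norm_sub_le _ _).trans (by linarith)
  have h2 := hA (x - y)
  have h3 : C * ‖A (x - y)‖ ^ 2 ≤ ε ^ 2 / 4 := by
    calc C * ‖A (x - y)‖ ^ 2 ≤ (C + 1) * δ ^ 2 := by gcongr; linarith
      _ = _ := by
        rw [hδ, div_pow, mul_pow, Real.sq_sqrt (by positivity)]
        field_simp
        norm_num
  have h4 : ε ^ 2 / (16 * (r ^ 2 + 1)) * ‖x - y‖ ^ 2 ≤ ε ^ 2 / 4 := by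
    calc _ ≤ ε ^ 2 / (16 * (r ^ 2 + 1)) * (2 * r) ^ 2 := by gcongr
      _ ≤ _ := by
        rw [div_mul_eq_mul_div, div_le_iff₀ (by positivity)]
        nlinarith [sq_nonneg ε, sq_nonneg r]
  exact lt_of_pow_lt_pow_left₀ 2 hε.le (by nlinarith)

/-- The `L²` modulus of continuity of a function is controlled by its gradient. -/
theorem lintegral_translate_sub_le {φ : Plane → ℂ} (hφ : ContDiff ℝ 1 φ) (h : Plane) :
    ∫⁻ y, ‖φ (y + h) - φ y‖ₑ ^ 2 ≤ ‖h‖ₑ ^ 2 * ∫⁻ y, ‖fderiv ℝ φ y‖ₑ ^ 2 := by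
  have hfc : Continuous (fderiv ℝ φ) := hφ.continuous_fderiv (by norm_num)
  have hpt : ∀ y, ‖φ (y + h) - φ y‖ₑ ^ 2 ≤
      ‖h‖ₑ ^ 2 * ∫⁻ t in Set.Ioc (0:ℝ) 1, ‖fderiv ℝ φ (y + t • h)‖ₑ ^ 2 := by
    intro y
    have hc : Continuous fun t : ℝ => fderiv ℝ φ (y + t • h) := hfc.comp (by fun_prop)
    have hd : ∀ t ∈ Set.uIcc (0:ℝ) 1, HasDerivAt (fun t : ℝ => φ (y + t • h))
        (fderiv ℝ φ (y + t • h) h) t := by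
      intro t _
      have h1 : HasDerivAt (fun t : ℝ => y + t • h) h t := by
        simpa using ((hasDerivAt_id t).smul_const h).const_add y
      exact ((hφ.differentiable (by norm_num)) (y + t • h)).hasFDerivAt.comp_hasDerivAt t h1
    have hftc := intervalIntegral.integral_eq_sub_of_hasDerivAt hd
      ((hc.clm_apply continuous_const).intervalIntegrable _ _)
    have h1 : ‖φ (y + h) - φ y‖ₑ ≤ ∫⁻ t in Set.Ioc (0:ℝ) 1, 1 * (‖fderiv ℝ φ (y + t • h)‖ₑ * ‖h‖ₑ) := by
      simp only [one_smul, zero_smul, add_zero] at hftc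
      rw [← hftc, intervalIntegral.integral_of_le zero_le_one]
      refine (enorm_integral_le_lintegral_enorm _).trans (lintegral_mono fun t => ?_)
      rw [one_mul]
      exact ContinuousLinearMap.le_opENorm _ _
    calc ‖φ (y + h) - φ y‖ₑ ^ 2
        ≤ (∫⁻ t in Set.Ioc (0:ℝ) 1, 1 * (‖fderiv ℝ φ (y + t • h)‖ₑ * ‖h‖ₑ)) ^ 2 := by gcongr
      _ ≤ (∫⁻ t in Set.Ioc (0:ℝ) 1, 1 ^ 2) *
          ∫⁻ t in Set.Ioc (0:ℝ) 1, (‖fderiv ℝ φ (y + t • h)‖ₑ * ‖h‖ₑ) ^ 2 := by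
          apply lintegral_mul_sq_le
          · fun_prop
          · exact (hc.enorm.measurable.mul_const _).aemeasurable
      _ = _ := by
          simp only [mul_pow, one_pow, setLIntegral_const, Real.volume_Ioc, sub_zero,
            ENNReal.ofReal_one, one_mul, mul_one]
          rw [lintegral_mul_const _ (hc.enorm.measurable.pow_const _), mul_comm]
  calc ∫⁻ y, ‖φ (y + h) - φ y‖ₑ ^ 2
      ≤ ∫⁻ y, ‖h‖ₑ ^ 2 * ∫⁻ t in Set.Ioc (0:ℝ) 1, ‖fderiv ℝ φ (y + t • h)‖ₑ ^ 2 :=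
        lintegral_mono hpt
    _ = ‖h‖ₑ ^ 2 * ∫⁻ t in Set.Ioc (0:ℝ) 1, ∫⁻ y, ‖fderiv ℝ φ (y + t • h)‖ₑ ^ 2 := by
        rw [lintegral_const_mul' _ _ (by finiteness), lintegral_lintegral_swap]
        refine Continuous.aemeasurable ?_
        exact (ENNReal.continuous_pow 2).comp (hfc.comp (by fun_prop)).enorm
    _ = _ := by
        congr 1
        have : ∀ t : ℝ, ∫⁻ y, ‖fderiv ℝ φ (y + t • h)‖ₑ ^ 2 = ∫⁻ y, ‖fderiv ℝ φ y‖ₑ ^ 2 :=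
          fun t => lintegral_add_right_eq_self (fun y => ‖fderiv ℝ φ y‖ₑ ^ 2) (t • h)
        simp_rw [this]
        simp

theorem ennreal_add_sq_le (a b : ℝ≥0∞) : (a + b) ^ 2 ≤ 2 * a ^ 2 + 2 * b ^ 2 := by
  have h := ENNReal.rpow_add_le_mul_rpow_add_rpow a b (p := 2) (by norm_num)
  norm_num at h
  rwa [mul_add] at h

/-- A local Poincaré-type inequality: the `L²` norm on a ball is controlled by the gradient and
finitely many averages. -/
theorem setLIntegral_enorm_sq_le {φ : Plane → ℂ} (hφ : ContDiff ℝ 1 φ)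
    {a : ℝ} (ha : 0 < a) {B : Set Plane} (hBm : MeasurableSet B)
    {t : Set Plane} (ht : B ⊆ ⋃ z ∈ t, Metric.ball z a) {m : ℝ≥0∞}
    (hm : ∀ z ∈ t, ‖∫ x in Metric.ball z a, φ x‖ₑ ≤ m) :
    ∫⁻ y in B, ‖φ y‖ₑ ^ 2 ≤ ENNReal.ofReal (32 * a ^ 2) * (∫⁻ y, ‖fderiv ℝ φ y‖ₑ ^ 2) +
      2 * volume B * ((volume (Metric.ball (0 : Plane) a)) ^ 2)⁻¹ * m ^ 2 := by
  set v := volume (Metric.ball (0 : Plane) a)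
  set D := ∫⁻ y, ‖fderiv ℝ φ y‖ₑ ^ 2
  have hv0 : v ≠ 0 := (Metric.measure_ball_pos volume _ ha).ne'
  have hvt : v ≠ ⊤ := measure_ball_lt_top.ne
  have hvz : ∀ z : Plane, volume (Metric.ball z a) = v := fun z =>
    Measure.addHaar_ball_center volume z a
  have hcont := hφ.continuous
  have hpt : ∀ y ∈ B, v ^ 2 * ‖φ y‖ₑ ^ 2 ≤ 2 * m ^ 2 +
      2 * (v * ∫⁻ h in Metric.ball (0 : Plane) (2 * a), ‖φ (y + h) - φ y‖ₑ ^ 2) := by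
    intro y hy
    obtain ⟨z, hz, hyz⟩ := Set.mem_iUnion₂.1 (ht hy)
    have hint : IntegrableOn φ (Metric.ball z a) :=
      (hcont.continuousOn.integrableOn_compact (isCompact_closedBall z a)).mono_set
        Metric.ball_subset_closedBall
    have hintc : IntegrableOn (fun _ : Plane => φ y) (Metric.ball z a) :=
      integrableOn_const measure_ball_lt_top.ne
    -- The value at `y` is compared with the average over a covering ball containing `y`; that ball
    -- lies in the ball of radius `2 * a` about `y`, which removes the dependence on `z`.
    have h1 : v * ‖φ y‖ₑ ≤ m + ∫⁻ x in Metric.ball z a, ‖φ x - φ y‖ₑ := by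
      have e : v * ‖φ y‖ₑ = ‖∫ x in Metric.ball z a, φ y‖ₑ := by
        rw [setIntegral_const, enorm_smul, measureReal_def, hvz, Real.enorm_of_nonneg (by positivity),
          ENNReal.ofReal_toReal hvt]
      rw [e, show (∫ x in Metric.ball z a, φ y) = (∫ x in Metric.ball z a, φ x) -
        ∫ x in Metric.ball z a, (φ x - φ y) by rw [integral_sub hint hintc]; ring]
      refine (enorm_sub_le).trans (add_le_add (hm z hz) (enorm_integral_le_lintegral_enorm _))
    have h2 : (∫⁻ x in Metric.ball z a, ‖φ x - φ y‖ₑ) ^ 2 ≤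
        v * ∫⁻ h in Metric.ball (0 : Plane) (2 * a), ‖φ (y + h) - φ y‖ₑ ^ 2 := by
      calc (∫⁻ x in Metric.ball z a, ‖φ x - φ y‖ₑ) ^ 2
          = (∫⁻ x in Metric.ball z a, 1 * ‖φ x - φ y‖ₑ) ^ 2 := by simp only [one_mul]
        _ ≤ (∫⁻ x in Metric.ball z a, 1 ^ 2) * ∫⁻ x in Metric.ball z a, ‖φ x - φ y‖ₑ ^ 2 := by
            apply lintegral_mul_sq_le
            · fun_prop
            · exact (hcont.sub continuous_const).enorm.measurable.aemeasurable
        _ = v * ∫⁻ x in Metric.ball z a, ‖φ x - φ y‖ₑ ^ 2 := by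
            simp only [one_pow, setLIntegral_const, one_mul, hvz]
        _ ≤ v * ∫⁻ x in Metric.ball y (2 * a), ‖φ x - φ y‖ₑ ^ 2 := by
            gcongr
            refine Metric.ball_subset_ball' ?_
            have := Metric.mem_ball'.1 hyz
            linarith
        _ = _ := by
            congr 1
            rw [← lintegral_indicator measurableSet_ball, ← lintegral_indicator measurableSet_ball,
              ← lintegral_add_left_eq_self _ y]
            congr 1; ext h
            simp only [Set.indicator, Metric.mem_ball, dist_self_add_left, dist_zero_right]
    calc v ^ 2 * ‖φ y‖ₑ ^ 2 = (v * ‖φ y‖ₑ) ^ 2 := by ring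
      _ ≤ (m + ∫⁻ x in Metric.ball z a, ‖φ x - φ y‖ₑ) ^ 2 := by gcongr
      _ ≤ 2 * m ^ 2 + 2 * (∫⁻ x in Metric.ball z a, ‖φ x - φ y‖ₑ) ^ 2 := ennreal_add_sq_le _ _
      _ ≤ _ := by gcongr
  have hmeas : Measurable (Function.uncurry fun y h : Plane => ‖φ (y + h) - φ y‖ₑ ^ 2) := by
    apply Continuous.measurable
    exact (ENNReal.continuous_pow 2).comp (Continuous.enorm (by fun_prop))
  have hdouble : ∫⁻ y in B, ∫⁻ h in Metric.ball (0 : Plane) (2 * a), ‖φ (y + h) - φ y‖ₑ ^ 2 ≤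
      ENNReal.ofReal (16 * a ^ 2) * v * D := by
    calc _ ≤ ∫⁻ y, ∫⁻ h in Metric.ball (0 : Plane) (2 * a), ‖φ (y + h) - φ y‖ₑ ^ 2 :=
          setLIntegral_le_lintegral _ _
      _ = ∫⁻ h in Metric.ball (0 : Plane) (2 * a), ∫⁻ y, ‖φ (y + h) - φ y‖ₑ ^ 2 :=
          lintegral_lintegral_swap hmeas.aemeasurable
      _ ≤ ∫⁻ h in Metric.ball (0 : Plane) (2 * a), ENNReal.ofReal (2 * a) ^ 2 * D := by
          refine setLIntegral_mono_ae' measurableSet_ball (ae_of_all _ fun h hh => ?_)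
          refine (lintegral_translate_sub_le hφ h).trans ?_
          gcongr
          rw [← ofReal_norm]
          exact ENNReal.ofReal_le_ofReal (mem_ball_zero_iff.1 hh).le
      _ = _ := by
          rw [setLIntegral_const, Measure.addHaar_ball_mul volume _ (by norm_num : (0:ℝ) ≤ 2),
            ← ENNReal.ofReal_pow (by positivity)]
          have : Module.finrank ℝ Plane = 2 := by simp
          rw [this, show (16 * a ^ 2 : ℝ) = (2 * a) ^ 2 * 2 ^ 2 by ring,
            ENNReal.ofReal_mul (by positivity : (0:ℝ) ≤ (2 * a) ^ 2)]
          ring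
  have hall : v ^ 2 * ∫⁻ y in B, ‖φ y‖ₑ ^ 2 ≤ v ^ 2 * (ENNReal.ofReal (32 * a ^ 2) * D +
      2 * volume B * (v ^ 2)⁻¹ * m ^ 2) := by
    calc v ^ 2 * ∫⁻ y in B, ‖φ y‖ₑ ^ 2 = ∫⁻ y in B, v ^ 2 * ‖φ y‖ₑ ^ 2 :=
          (lintegral_const_mul' _ _ (by finiteness)).symm
      _ ≤ ∫⁻ y in B, (2 * m ^ 2 +
          2 * (v * ∫⁻ h in Metric.ball (0 : Plane) (2 * a), ‖φ (y + h) - φ y‖ₑ ^ 2)) :=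
          setLIntegral_mono_ae' hBm (ae_of_all _ hpt)
      _ = 2 * m ^ 2 * volume B + 2 * (v * ∫⁻ y in B,
          ∫⁻ h in Metric.ball (0 : Plane) (2 * a), ‖φ (y + h) - φ y‖ₑ ^ 2) := by
          rw [lintegral_add_left measurable_const, setLIntegral_const,
            lintegral_const_mul' _ _ (by finiteness), lintegral_const_mul' _ _ hvt]
      _ ≤ 2 * m ^ 2 * volume B + 2 * (v * (ENNReal.ofReal (16 * a ^ 2) * v * D)) := by gcongr
      _ = _ := by
          rw [mul_add, show v ^ 2 * (2 * volume B * (v ^ 2)⁻¹ * m ^ 2) =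
            (v ^ 2 * (v ^ 2)⁻¹) * (2 * volume B * m ^ 2) by ring,
            ENNReal.mul_inv_cancel (by positivity) (by finiteness),
            show (32 * a ^ 2 : ℝ) = 2 * (16 * a ^ 2) by ring, ENNReal.ofReal_mul (by norm_num)]
          norm_num
          ring
  exact (ENNReal.mul_le_mul_iff_right (by positivity) (by finiteness)).1 hall

/-- The integrals of the first component over the balls of radius `a` centred at `t`. -/
def ballIntegrals (V : Plane → ℝ) (c a : ℝ) (t : Finset Plane) : formDomain V c →L[ℂ] (t → ℂ) :=
  ContinuousLinearMap.pi fun z => (innerSL ℂ (indicatorConstLp 2 measurableSet_ball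
    (measure_ball_lt_top (μ := volume) (x := (z : Plane)) (r := a)).ne (1 : ℂ))).comp
      (formEmbedding V c)

theorem ballIntegrals_apply {V : Plane → ℝ} {c a : ℝ} {t : Finset Plane} (ξ : formDomain V c)
    (z : t) : ballIntegrals V c a t ξ z = ∫ x in Metric.ball (z : Plane) a, formEmbedding V c ξ x :=
  L2.inner_indicatorConstLp_one _ _ _

theorem sq_le_of_enorm_sq_le {X Y Z : Type*} [NormedAddCommGroup X] [NormedAddCommGroup Y]
    [NormedAddCommGroup Z] {x : X} {y : Y} {z : Z} {ε : ℝ} {C : ℝ≥0∞} (hε : 0 ≤ ε) (hC : C ≠ ⊤)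
    (h : ‖x‖ₑ ^ 2 ≤ ENNReal.ofReal ε * ‖y‖ₑ ^ 2 + C * ‖z‖ₑ ^ 2) :
    ‖x‖ ^ 2 ≤ ε * ‖y‖ ^ 2 + C.toReal * ‖z‖ ^ 2 := by
  rw [← ofReal_norm, ← ofReal_norm, ← ofReal_norm, ← ENNReal.ofReal_pow (norm_nonneg _),
    ← ENNReal.ofReal_pow (norm_nonneg _), ← ENNReal.ofReal_pow (norm_nonneg _),
    ← ENNReal.ofReal_mul hε, ← ENNReal.ofReal_toReal hC,
    ← ENNReal.ofReal_mul ENNReal.toReal_nonneg,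
    ← ENNReal.ofReal_add (by positivity) (by positivity)] at h
  exact (ENNReal.ofReal_le_ofReal_iff (by positivity)).1 h

set_option maxHeartbeats 1000000 in
/-- The first component of a vector in the form domain is controlled in `L²` by finitely many
ball averages, up to a small multiple of the form norm. -/
theorem exists_finite_rank_bound {V : Plane → ℝ} {s c : ℝ} (hs : 0 < s) (hc : 0 < c)
    (hV : ∀ x, c⁻¹ * ‖x‖ ^ s - c ≤ V x) {ε : ℝ} (hε : 0 < ε) :
    ∃ (t : Finset Plane) (A : formDomain V c →L[ℂ] (t → ℂ)) (C : ℝ), 0 ≤ C ∧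
      ∀ ξ, ‖formEmbedding V c ξ‖ ^ 2 ≤ ε * ‖ξ‖ ^ 2 + C * ‖A ξ‖ ^ 2 := by
  -- Outside radius `R` confinement gives `V + c ≥ 2 / ε`, so the mass there is at most `ε / 2`
  -- times the squared form norm.
  obtain ⟨R, hR0, hR⟩ : ∃ R : ℝ, 0 < R ∧ 1 ≤ ε / 2 * (c⁻¹ * R ^ s) := by
    have h1 : Tendsto (fun R : ℝ => ε / 2 * (c⁻¹ * R ^ s)) atTop atTop :=
      ((tendsto_rpow_atTop hs).const_mul_atTop (by positivity)).const_mul_atTop (by positivity)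
    obtain ⟨R, h2, h3⟩ := ((eventually_gt_atTop 0).and (h1.eventually_ge_atTop 1)).exists
    exact ⟨R, h2, h3⟩
  -- This radius makes the gradient coefficient `32 * a ^ 2` of the local estimate equal to the
  -- other `ε / 2`.
  set a : ℝ := Real.sqrt (ε / 64) with ha_def
  have ha : 0 < a := by positivity
  have ha2 : 32 * a ^ 2 = ε / 2 := by rw [ha_def, Real.sq_sqrt (by positivity)]; ring
  set B := Metric.closedBall (0 : Plane) R
  obtain ⟨t, htf⟩ := (isCompact_closedBall (0 : Plane) R).elim_finite_subcover
    (fun z : Plane => Metric.ball z a) (fun _ => Metric.isOpen_ball)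
    (fun x _ => Set.mem_iUnion.2 ⟨x, Metric.mem_ball_self ha⟩)
  set C : ℝ≥0∞ := 2 * volume B * ((volume (Metric.ball (0 : Plane) a)) ^ 2)⁻¹ with hC_def
  have hCt : C ≠ ⊤ := by
    refine ENNReal.mul_ne_top (ENNReal.mul_ne_top (by simp) measure_closedBall_lt_top.ne) ?_
    exact ENNReal.inv_ne_top.2 (pow_ne_zero _ (Metric.measure_ball_pos volume _ ha).ne')
  refine ⟨t, ballIntegrals V c a t, C.toReal, ENNReal.toReal_nonneg, ?_⟩
  have hsmooth : ∀ η : formDomain V c,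
      (η : Lp (EuclideanSpace ℂ (Fin 4)) 2 (volume : Measure Plane)) ∈ smoothForms V c →
      ‖formEmbedding V c η‖ ^ 2 ≤ ε * ‖η‖ ^ 2 + C.toReal * ‖ballIntegrals V c a t η‖ ^ 2 := by
    rintro η ⟨φ, hφ, -, hae⟩
    have hJ : formEmbedding V c η =ᵐ[volume] φ := by
      filter_upwards [coeFn_formEmbedding η, hae] with x hx hx1
      rw [hx, hx1]; rfl
    have hφ1 : ContDiff ℝ 1 φ := hφ.of_le (by simp)
    have e1 : ‖formEmbedding V c η‖ₑ ^ 2 = ∫⁻ x, ‖φ x‖ₑ ^ 2 := by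
      rw [← lintegral_enorm_sq_eq_enorm_sq]
      exact lintegral_congr_ae (hJ.mono fun x hx => by simp only [hx])
    have e2 : ‖η‖ₑ ^ 2 = ∫⁻ x, ‖formVector V c φ x‖ₑ ^ 2 := by
      rw [show ‖η‖ₑ = ‖(η : Lp (EuclideanSpace ℂ (Fin 4)) 2 (volume : Measure Plane))‖ₑ from rfl,
        ← lintegral_enorm_sq_eq_enorm_sq]
      exact lintegral_congr_ae (hae.mono fun x hx => by simp only [hx])
    have hgrad : ∫⁻ y, ‖fderiv ℝ φ y‖ₑ ^ 2 ≤ ‖η‖ₑ ^ 2 := by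
      rw [e2]
      refine lintegral_mono fun x => ?_
      rw [← ofReal_norm, ← ofReal_norm, ← ENNReal.ofReal_pow (norm_nonneg _),
        ← ENNReal.ofReal_pow (norm_nonneg _)]
      apply ENNReal.ofReal_le_ofReal
      rw [norm_formVector_sq]
      have h1 := norm_fderiv_sq_le φ x
      have h2 : 0 ≤ Real.sqrt (V x + c) ^ 2 * ‖φ x‖ ^ 2 := by positivity
      nlinarith [sq_nonneg ‖φ x‖]
    have hin : ∫⁻ y in B, ‖φ y‖ₑ ^ 2 ≤ ENNReal.ofReal (ε / 2) * ‖η‖ₑ ^ 2 +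
        C * ‖ballIntegrals V c a t η‖ₑ ^ 2 := by
      refine (setLIntegral_enorm_sq_le hφ1 ha measurableSet_closedBall (t := (t : Set Plane))
        (m := ‖ballIntegrals V c a t η‖ₑ) (by simpa using htf) fun z hz => ?_).trans ?_
      · have := norm_le_pi_norm (ballIntegrals V c a t η) ⟨z, hz⟩
        rw [ballIntegrals_apply, setIntegral_congr_ae measurableSet_ball
          (hJ.mono fun x hx _ => hx)] at this
        rw [← ofReal_norm, ← ofReal_norm]
        exact ENNReal.ofReal_le_ofReal this
      · rw [ha2]; gcongr
    have hout : ∫⁻ y in Bᶜ, ‖φ y‖ₑ ^ 2 ≤ ENNReal.ofReal (ε / 2) * ‖η‖ₑ ^ 2 := by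
      rw [e2, ← lintegral_const_mul' _ _ ENNReal.ofReal_ne_top]
      refine le_trans (setLIntegral_mono_ae' measurableSet_closedBall.compl
        (ae_of_all _ fun x hx => ?_)) (setLIntegral_le_lintegral _ _)
      rw [← ofReal_norm, ← ofReal_norm, ← ENNReal.ofReal_pow (norm_nonneg _),
        ← ENNReal.ofReal_pow (norm_nonneg _), ← ENNReal.ofReal_mul (by positivity)]
      apply ENNReal.ofReal_le_ofReal
      have hxR : R < ‖x‖ := by simpa [B] using hx
      have h1 : c⁻¹ * R ^ s ≤ V x + c := by
        have : c⁻¹ * R ^ s ≤ c⁻¹ * ‖x‖ ^ s := by gcongr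
        linarith [hV x]
      have h0 : 0 ≤ V x + c := le_trans (by positivity) h1
      rw [norm_formVector_sq, Real.sq_sqrt h0]
      have h2 : 1 ≤ ε / 2 * (V x + c) := hR.trans (by gcongr)
      have h3 : ‖φ x‖ ^ 2 ≤ ε / 2 * (V x + c) * ‖φ x‖ ^ 2 :=
        le_mul_of_one_le_left (by positivity) h2
      have h4 : 0 ≤ ε / 2 * (‖φ x‖ ^ 2 + ‖partialD 0 φ x‖ ^ 2 + ‖partialD 1 φ x‖ ^ 2) := by
        positivity
      nlinarith
    have htot : ‖formEmbedding V c η‖ₑ ^ 2 ≤ ENNReal.ofReal ε * ‖η‖ₑ ^ 2 +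
        C * ‖ballIntegrals V c a t η‖ₑ ^ 2 := by
      rw [e1, ← lintegral_add_compl _ (measurableSet_closedBall : MeasurableSet B)]
      refine (add_le_add hin hout).trans (le_of_eq ?_)
      rw [add_right_comm, ← add_mul, ← ENNReal.ofReal_add (by positivity) (by positivity),
        add_halves]
    exact sq_le_of_enorm_sq_le hε.le hCt htot
  intro ξ
  obtain ⟨η, hη, hlim⟩ := exists_seq_smoothForms ξ
  refine le_of_tendsto_of_tendsto' (b := atTop) (f := fun n => ‖formEmbedding V c (η n)‖ ^ 2)
    (g := fun n => ε * ‖η n‖ ^ 2 + C.toReal * ‖ballIntegrals V c a t (η n)‖ ^ 2) ?_ ?_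
    fun n => hsmooth _ (hη n)
  · exact ((((formEmbedding V c).continuous.norm).pow 2).tendsto ξ).comp hlim
  · have hc : Continuous fun ξ : formDomain V c =>
        ε * ‖ξ‖ ^ 2 + C.toReal * ‖ballIntegrals V c a t ξ‖ ^ 2 :=
      (continuous_const.mul (continuous_norm.pow 2)).add
        (continuous_const.mul ((ballIntegrals V c a t).continuous.norm.pow 2))
    exact (hc.tendsto ξ).comp hlim

/-- A confining potential makes the form domain compactly embedded in `L²`. -/
theorem totallyBounded_formEmbedding {V : Plane → ℝ} {s c : ℝ} (hs : 0 < s) (hc : 0 < c)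
    (hV : ∀ x, c⁻¹ * ‖x‖ ^ s - c ≤ V x) (r : ℝ) :
    TotallyBounded (formEmbedding V c '' Metric.closedBall 0 r) :=
  totallyBounded_image_closedBall _ (fun _ hε => exists_finite_rank_bound hs hc hV hε) r

/-! ### Low-energy vectors as bounded functions plus small errors -/

set_option maxHeartbeats 1000000 in
/-- Uniformly on the unit ball of a low-energy space, vectors are bounded functions up to an error
that is small in the form domain. -/
theorem exists_bounded_approx {V : Plane → ℝ} {s c : ℝ} (hs : 0 < s) (hc : 0 < c)
    (hV : ∀ x, c⁻¹ * ‖x‖ ^ s - c ≤ V x) {K : ℝ} (hK : 0 < K) {ε : ℝ} (hε : 0 < ε) :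
    ∃ B : ℝ, ∀ u ∈ lowEnergySpace V c K, ‖u‖ ≤ 1 → ∃ (φ : Plane → ℂ) (ζ : formDomain V c),
      (∀ x, ‖φ x‖ ≤ B) ∧ ‖ζ‖ ≤ ε ∧ u =ᵐ[volume] fun x => φ x + formEmbedding V c ζ x := by
  obtain ⟨L, hL⟩ := exists_formDomain_lift V hc hK
  set J := formEmbedding V c
  set S : Set OneBody := {u | u ∈ lowEnergySpace V c K ∧ ‖u‖ ≤ 1}
  have hSJ : S ⊆ J '' Metric.closedBall 0 (Real.sqrt (K ^ 2 + c + 1)) := by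
    rintro u ⟨hu, hu1⟩
    obtain ⟨h1, h2⟩ := hL u hu
    refine ⟨L u, ?_, h1⟩
    rw [mem_closedBall_zero_iff]
    refine Real.le_sqrt_of_sq_le (h2.trans ?_)
    have : ‖u‖ ^ 2 ≤ 1 := pow_le_one₀ (norm_nonneg _) hu1
    exact mul_le_of_le_one_right (by positivity) this
  -- Precompactness in `L²` is upgraded to the form norm, because on low-energy vectors the lift `L`
  -- is bounded from `L²` into the form domain.
  have htb : TotallyBounded (L '' S) :=
    ((totallyBounded_formEmbedding hs hc hV _).subset hSJ).image L.uniformContinuous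
  obtain ⟨T, hTf, hT⟩ := Metric.totallyBounded_iff.1 htb (ε / 2) (by positivity)
  -- Each centre of the net is replaced by a nearby test function, which is bounded; finiteness of
  -- the net makes the bound uniform.
  have hsm : ∀ ξ : formDomain V c, ∃ (B : ℝ) (φ : Plane → ℂ) (η : formDomain V c),
      (∀ x, ‖φ x‖ ≤ B) ∧ dist η ξ < ε / 2 ∧ J η =ᵐ[volume] φ := by
    intro ξ
    obtain ⟨η, hη, hlim⟩ := exists_seq_smoothForms ξ
    obtain ⟨n, hn⟩ := (hlim.eventually (Metric.ball_mem_nhds ξ (half_pos hε))).exists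
    obtain ⟨φ, hφ, hφc, hae⟩ := hη n
    obtain ⟨B, hB⟩ := hφc.exists_bound_of_continuous hφ.continuous
    refine ⟨B, φ, η n, hB, hn, ?_⟩
    filter_upwards [coeFn_formEmbedding (η n), hae] with x hx hx1
    rw [hx, hx1]; rfl
  choose B φ η hB hη hφ using hsm
  obtain ⟨B₀, hB₀⟩ := (hTf.image B).bddAbove
  refine ⟨B₀, fun u hu hu1 => ?_⟩
  obtain ⟨ξ, hξ, hξ'⟩ := Set.mem_iUnion₂.1 (hT ⟨u, ⟨hu, hu1⟩, rfl⟩)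
  refine ⟨φ ξ, L u - η ξ, fun x => (hB ξ x).trans (hB₀ ⟨ξ, hξ, rfl⟩), ?_, ?_⟩
  · rw [← dist_eq_norm]
    have h1 : dist (L u) ξ < ε / 2 := hξ'
    have h2 := dist_triangle_right (L u) (η ξ) ξ
    linarith [hη ξ]
  · have h1 : u = J (η ξ) + J (L u - η ξ) := by
      rw [map_sub, (hL u hu).1]
      exact (add_sub_cancel _ u).symm
    have h2 : u =ᵐ[volume] ⇑(J (η ξ) + J (L u - η ξ)) := by rw [← h1]
    filter_upwards [h2, Lp.coeFn_add (J (η ξ)) (J (L u - η ξ)), hφ ξ] with x hx hx1 hx2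
    rw [hx, hx1, Pi.add_apply, hx2]

/-- On a fixed low-energy space, the constant of the logarithmic trace inequality is arbitrarily
small up to a multiple of the `L¹` norm of the potential. -/
theorem exists_lintegral_mul_lowEnergy_le {V : Plane → ℝ} {s c : ℝ} (hs : 0 < s) (hc : 0 < c)
    (hV : ∀ x, c⁻¹ * ‖x‖ ^ s - c ≤ V x) {K : ℝ} (hK : 0 < K) {ε : ℝ} (hε : 0 < ε) :
    ∃ B : ℝ, ∀ u ∈ lowEnergySpace V c K, ∀ (ρ : Plane → ℝ≥0∞) (M : ℝ≥0∞), AEMeasurable ρ →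
      (∀ ξ : formDomain V c, ∫⁻ y, ρ y * ‖formEmbedding V c ξ y‖ₑ ^ 2 ≤ M * ‖ξ‖ₑ ^ 2) →
      ∫⁻ y, ρ y * ‖u y‖ₑ ^ 2 ≤
        (ENNReal.ofReal B * (∫⁻ y, ρ y) + ENNReal.ofReal ε * M) * ‖u‖ₑ ^ 2 := by
  -- The tolerance `√(ε / 2)` offsets the factor `2` in `(a + b)² ≤ 2 a² + 2 b²`.
  obtain ⟨B, hB⟩ := exists_bounded_approx hs hc hV hK (Real.sqrt_pos.2 (half_pos hε))
  refine ⟨2 * B ^ 2, fun u hu ρ M hρ hM => ?_⟩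
  have hunit : ∀ u ∈ lowEnergySpace V c K, ‖u‖ ≤ 1 → ∫⁻ y, ρ y * ‖u y‖ₑ ^ 2 ≤
      ENNReal.ofReal (2 * B ^ 2) * (∫⁻ y, ρ y) + ENNReal.ofReal ε * M := by
    intro u hu hu1
    obtain ⟨φ, ζ, hφ, hζ, hae⟩ := hB u hu hu1
    calc ∫⁻ y, ρ y * ‖u y‖ₑ ^ 2
        ≤ ∫⁻ y, (ENNReal.ofReal (2 * B ^ 2) * ρ y +
            2 * (ρ y * ‖formEmbedding V c ζ y‖ₑ ^ 2)) := by
          refine lintegral_mono_ae ?_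
          filter_upwards [hae] with x hx
          rw [hx]
          have h1 : ‖φ x‖ₑ ≤ ENNReal.ofReal B := by
            rw [← ofReal_norm]; exact ENNReal.ofReal_le_ofReal (hφ x)
          have hB0 : 0 ≤ B := (norm_nonneg _).trans (hφ x)
          calc ρ x * ‖φ x + formEmbedding V c ζ x‖ₑ ^ 2
              ≤ ρ x * (2 * ENNReal.ofReal B ^ 2 + 2 * ‖formEmbedding V c ζ x‖ₑ ^ 2) := by
                gcongr
                refine le_trans ?_ (ennreal_add_sq_le _ _)
                gcongr
                exact (enorm_add_le _ _).trans (by gcongr)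
            _ = _ := by
                rw [ENNReal.ofReal_mul (by norm_num), ENNReal.ofReal_pow hB0]
                norm_num
                ring
      _ = ENNReal.ofReal (2 * B ^ 2) * (∫⁻ y, ρ y) +
            2 * ∫⁻ y, ρ y * ‖formEmbedding V c ζ y‖ₑ ^ 2 := by
          rw [lintegral_add_left' (hρ.const_mul _), lintegral_const_mul' _ _ ENNReal.ofReal_ne_top,
            lintegral_const_mul' _ _ (by simp)]
      _ ≤ _ := by
          refine add_le_add le_rfl ?_
          have h1 : ‖ζ‖ₑ ^ 2 ≤ ENNReal.ofReal (ε / 2) := by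
            rw [← ofReal_norm, ← ENNReal.ofReal_pow (norm_nonneg _)]
            apply ENNReal.ofReal_le_ofReal
            calc ‖ζ‖ ^ 2 ≤ Real.sqrt (ε / 2) ^ 2 := by gcongr
              _ = _ := Real.sq_sqrt (by positivity)
          calc _ ≤ 2 * (M * ENNReal.ofReal (ε / 2)) := by
                gcongr
                exact (hM ζ).trans (by gcongr)
            _ = ENNReal.ofReal (2 * (ε / 2)) * M := by
                rw [ENNReal.ofReal_mul (by norm_num)]; norm_num; ring
            _ = _ := by rw [mul_div_cancel₀ _ (by norm_num)]
  rcases eq_or_ne u 0 with rfl | hu0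
  · have : ∫⁻ y, ρ y * ‖(0 : OneBody) y‖ₑ ^ 2 = 0 := by
      rw [lintegral_congr_ae (g := fun _ => 0), lintegral_zero]
      filter_upwards [Lp.coeFn_zero ℂ 2 (volume : Measure Plane)] with x hx
      rw [hx]; simp
    rw [this]; exact zero_le
  · have hn : ‖u‖ ≠ 0 := norm_ne_zero_iff.2 hu0
    set a : ℂ := ((‖u‖⁻¹ : ℝ) : ℂ)
    have ha : ‖a‖ₑ = ‖u‖ₑ⁻¹ := by
      rw [← ofReal_norm, ← ofReal_norm, ← ENNReal.ofReal_inv_of_pos (by positivity)]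
      congr 1
      simp [a]
    have h1 := hunit (a • u) (Submodule.smul_mem _ _ hu) (by
      rw [norm_smul]; simp [a, inv_mul_cancel₀ hn])
    have h2 : ∫⁻ y, ρ y * ‖(a • u) y‖ₑ ^ 2 = ‖a‖ₑ ^ 2 * ∫⁻ y, ρ y * ‖u y‖ₑ ^ 2 := by
      rw [← lintegral_const_mul' _ _ (by finiteness)]
      refine lintegral_congr_ae ?_
      filter_upwards [Lp.coeFn_smul a u] with x hx
      rw [hx, Pi.smul_apply, enorm_smul]; ring
    have hu1 : ‖u‖ₑ ≠ 0 := by simpa using hu0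
    calc ∫⁻ y, ρ y * ‖u y‖ₑ ^ 2 = (‖a‖ₑ ^ 2 * ∫⁻ y, ρ y * ‖u y‖ₑ ^ 2) * ‖u‖ₑ ^ 2 := by
          rw [ha, mul_right_comm, ← mul_pow, ENNReal.inv_mul_cancel hu1 (by finiteness), one_pow,
            one_mul]
      _ ≤ _ := by rw [← h2]; gcongr

/-! ### Scaling of the interaction -/

theorem lintegral_comp_smul_plane (f : Plane → ℝ≥0∞) {r : ℝ} (hr : 0 < r) :
    ∫⁻ x, f (r • x) = ENNReal.ofReal (r ^ 2)⁻¹ * ∫⁻ x, f x := by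
  have h := (measurableEmbedding_const_smul₀ (α := Plane) hr.ne').lintegral_map (μ := volume) f
  rw [Measure.map_addHaar_smul volume hr.ne', lintegral_smul_measure] at h
  rw [← h]
  simp [abs_of_pos hr]

theorem lintegral_scaledPotential (w : Plane → ℝ) (β : ℝ) {N : ℕ} (hN : 0 < N) (z : Plane) :
    ∫⁻ y, ‖scaledPotential w β N (z - y)‖ₑ = eLpNorm w 1 volume := by
  have hN' : (0:ℝ) < N := Nat.cast_pos.2 hN
  set r := (N : ℝ) ^ β
  have hr : 0 < r := Real.rpow_pos_of_pos hN' _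
  have hr2 : (N : ℝ) ^ (2 * β) = r ^ 2 := by
    rw [mul_comm, Real.rpow_mul hN'.le]; norm_num [r]
  rw [lintegral_sub_left_eq_self (fun y => ‖scaledPotential w β N y‖ₑ) z,
    eLpNorm_one_eq_lintegral_enorm]
  have : ∀ y, ‖scaledPotential w β N y‖ₑ = ENNReal.ofReal (r ^ 2) * ‖w (r • y)‖ₑ := by
    intro y
    rw [scaledPotential, enorm_mul, hr2, Real.enorm_of_nonneg (by positivity)]
  simp_rw [this]
  rw [lintegral_const_mul' _ _ ENNReal.ofReal_ne_top, lintegral_comp_smul_plane (fun x => ‖w x‖ₑ) hr,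
    ← mul_assoc, ← ENNReal.ofReal_mul (by positivity), mul_inv_cancel₀ (by positivity),
    ENNReal.ofReal_one, one_mul]

/-- The `L²` norm grows exactly like `N^β`; this fixes the choice `δ = N^{-β}` in the trace
inequality. -/
theorem lintegral_scaledPotential_sq (w : Plane → ℝ) (β : ℝ) {N : ℕ} (hN : 0 < N) (z : Plane) :
    ENNReal.ofReal ((N : ℝ) ^ β)⁻¹ *
      (∫⁻ y, ‖scaledPotential w β N (z - y)‖ₑ ^ 2) ^ (1 / 2 : ℝ) = eLpNorm w 2 volume := by
  have hN' : (0:ℝ) < N := Nat.cast_pos.2 hN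
  set r := (N : ℝ) ^ β
  have hr : 0 < r := Real.rpow_pos_of_pos hN' _
  have hr2 : (N : ℝ) ^ (2 * β) = r ^ 2 := by
    rw [mul_comm, Real.rpow_mul hN'.le]; norm_num [r]
  rw [lintegral_sub_left_eq_self (fun y => ‖scaledPotential w β N y‖ₑ ^ 2) z,
    eLpNorm_eq_lintegral_rpow_enorm_toReal (by simp) (by simp)]
  have : ∀ y, ‖scaledPotential w β N y‖ₑ ^ 2 =
      ENNReal.ofReal ((r ^ 2) ^ 2) * ‖w (r • y)‖ₑ ^ (2 : ℝ) := by
    intro y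
    rw [scaledPotential, enorm_mul, hr2, Real.enorm_of_nonneg (by positivity), mul_pow,
      ← ENNReal.ofReal_pow (by positivity), ENNReal.rpow_two]
  simp_rw [this]
  rw [lintegral_const_mul' _ _ ENNReal.ofReal_ne_top,
    lintegral_comp_smul_plane (fun x => ‖w x‖ₑ ^ (2:ℝ)) hr,
    ← mul_assoc, ← ENNReal.ofReal_mul (by positivity),
    show (r ^ 2) ^ 2 * (r ^ 2)⁻¹ = r ^ 2 by field_simp,
    ENNReal.mul_rpow_of_nonneg _ _ (by norm_num), ENNReal.ofReal_rpow_of_pos (by positivity),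
    ← Real.sqrt_eq_rpow, Real.sqrt_sq hr.le, ← mul_assoc, ← ENNReal.ofReal_mul (by positivity),
    inv_mul_cancel₀ hr.ne', ENNReal.ofReal_one, one_mul]
  norm_num

theorem aestronglyMeasurable_scaledPotential {w : Plane → ℝ} (hw : AEStronglyMeasurable w volume)
    (β : ℝ) {N : ℕ} (hN : 0 < N) : AEStronglyMeasurable (scaledPotential w β N) volume := by
  have hr : (N : ℝ) ^ β ≠ 0 := (Real.rpow_pos_of_pos (Nat.cast_pos.2 hN) _).ne'
  have hq : Measure.QuasiMeasurePreserving (fun x : Plane => (N : ℝ) ^ β • x) volume volume := by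
    refine ⟨by fun_prop, ?_⟩
    rw [Measure.map_addHaar_smul volume hr]
    exact Measure.smul_absolutelyContinuous
  exact (hw.comp_quasiMeasurePreserving hq).const_mul _

theorem aemeasurable_scaledPotential_sub {w : Plane → ℝ} (hw : AEStronglyMeasurable w volume)
    (β : ℝ) {N : ℕ} (hN : 0 < N) (z : Plane) :
    AEMeasurable (fun y => ‖scaledPotential w β N (z - y)‖ₑ) :=
  ((aestronglyMeasurable_scaledPotential hw β hN).comp_quasiMeasurePreserving
    (quasiMeasurePreserving_sub_left volume z)).enorm

/-- The logarithmic trace inequality for the scaled interaction. -/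
theorem lintegral_scaledPotential_mul_formEmbedding_le {w : Plane → ℝ} (hw1 : MemLp w 1 volume)
    (hw2 : MemLp w 2 volume) {β : ℝ} (hβ : 0 < β) {V : Plane → ℝ} {c : ℝ} {N : ℕ} (hN : 0 < N)
    (hN2 : 2 ≤ β * Real.log N) (z : Plane) (ξ : formDomain V c) :
    ∫⁻ y, ‖scaledPotential w β N (z - y)‖ₑ * ‖formEmbedding V c ξ y‖ₑ ^ 2 ≤
      ENNReal.ofReal (4 * (β * Real.log N) *
        ((eLpNorm w 1 volume).toReal + (eLpNorm w 2 volume).toReal)) * ‖ξ‖ₑ ^ 2 := by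
  have hN' : (0:ℝ) < N := Nat.cast_pos.2 hN
  have hr : 1 ≤ (N : ℝ) ^ β := Real.one_le_rpow (by exact_mod_cast hN) hβ.le
  have hS : eLpNorm w 1 volume + eLpNorm w 2 volume ≠ ⊤ := ENNReal.add_ne_top.2 ⟨hw1.2.ne, hw2.2.ne⟩
  have h := lintegral_mul_formEmbedding_le (δ := ((N : ℝ) ^ β)⁻¹) (by positivity)
    (inv_le_one_of_one_le₀ hr) (aemeasurable_scaledPotential_sub hw1.1 β hN z)
    (S := eLpNorm w 1 volume + eLpNorm w 2 volume)
    (by rw [lintegral_scaledPotential w β hN, lintegral_scaledPotential_sq w β hN]) hS ξ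
  refine h.trans (mul_le_mul' ?_ le_rfl)
  rw [ENNReal.ofReal_mul' (add_nonneg ENNReal.toReal_nonneg ENNReal.toReal_nonneg),
    ← ENNReal.toReal_add hw1.2.ne hw2.2.ne,
    ENNReal.ofReal_toReal hS]
  -- Since `log(1/δ) = β log N ≥ 2`, the additive `2` is absorbed: `2 (β log N + 2) ≤ 4 β log N`.
  refine mul_le_mul' (ENNReal.ofReal_le_ofReal ?_) le_rfl
  rw [one_div, inv_inv, Real.log_rpow hN']
  linarith

/-! ### The one-body estimate -/

set_option maxHeartbeats 1000000 in
/-- The one-body estimate: on the range of `1_{√h < K}` the scaled interaction, centred at any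
point, is bounded by `β K² log N`. -/
theorem eventually_lintegral_scaledPotential_le {w : Plane → ℝ} (hw1 : MemLp w 1 volume)
    (hw2 : MemLp w 2 volume) {β : ℝ} (hβ : 0 < β) {V : Plane → ℝ} {s c : ℝ} (hs : 0 < s)
    (hc : 0 < c) (hV : ∀ x, c⁻¹ * ‖x‖ ^ s - c ≤ V x) {κ : ℝ} (hκ : 0 < κ) :
    ∀ᶠ N : ℕ in atTop, ∀ K : ℝ, κ ≤ K → ∀ u ∈ lowEnergySpace V c K, ∀ z : Plane,
      ∫⁻ y, ‖scaledPotential w β N (z - y)‖ₑ * ‖u y‖ₑ ^ 2 ≤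
        ENNReal.ofReal ((12 * ((eLpNorm w 1 volume).toReal + (eLpNorm w 2 volume).toReal) + 1) *
          (β * K ^ 2 * Real.log N)) * ‖u‖ₑ ^ 2 := by
  set a := (eLpNorm w 1 volume).toReal with ha_def
  set b := (eLpNorm w 2 volume).toReal
  have ha : 0 ≤ a := ENNReal.toReal_nonneg
  have hb : 0 ≤ b := ENNReal.toReal_nonneg
  have hae : eLpNorm w 1 volume = ENNReal.ofReal a := (ENNReal.ofReal_toReal hw1.2.ne).symm
  -- Above this threshold `K ^ 2 + c + 1 ≤ 3 * K ^ 2`, whence the constant `12 = 4 * 3`; below it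
  -- compactness is used on the single space at level `K₀`.
  set K₀ : ℝ := max (Real.sqrt c) 1
  have hK₀1 : 1 ≤ K₀ := le_max_right _ _
  have hK₀c : c ≤ K₀ ^ 2 := by
    calc c = Real.sqrt c ^ 2 := (Real.sq_sqrt hc.le).symm
      _ ≤ K₀ ^ 2 := by gcongr; exact le_max_left _ _
  -- With this `ε` the logarithmic error is at most half of `β κ² log N`. The last lower bound on
  -- `N` below puts the `B` term in the other half; `B` depends on neither `N` nor `K`.
  set ε : ℝ := κ ^ 2 / (8 * (a + b + 1)) with hε_def
  have hε : 0 < ε := by positivity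
  obtain ⟨B, hB⟩ := exists_lintegral_mul_lowEnergy_le hs hc hV (by linarith : 0 < K₀) hε
  have hlog : Tendsto (fun N : ℕ => β * Real.log N) atTop atTop :=
    (Real.tendsto_log_atTop.comp tendsto_natCast_atTop_atTop).const_mul_atTop hβ
  filter_upwards [eventually_gt_atTop 0, hlog.eventually_ge_atTop 2,
    hlog.eventually_ge_atTop (2 * |B| * a / κ ^ 2)] with N hN hN2 hNB K hK u hu z
  set ℓ := β * Real.log N
  set ρ : Plane → ℝ≥0∞ := fun y => ‖scaledPotential w β N (z - y)‖ₑ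
  have hρ : AEMeasurable ρ := aemeasurable_scaledPotential_sub hw1.1 β hN z
  have h1 : ∫⁻ y, ρ y = ENNReal.ofReal a := (lintegral_scaledPotential w β hN z).trans hae
  have hform : ∀ ξ : formDomain V c, ∫⁻ y, ρ y * ‖formEmbedding V c ξ y‖ₑ ^ 2 ≤
      ENNReal.ofReal (4 * ℓ * (a + b)) * ‖ξ‖ₑ ^ 2 :=
    lintegral_scaledPotential_mul_formEmbedding_le hw1 hw2 hβ hN hN2 z
  have hℓ : 0 ≤ ℓ := by linarith
  have hK0 : 0 < K := hκ.trans_le hK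
  rcases le_total K₀ K with hKK | hKK
  · obtain ⟨L, hL⟩ := exists_formDomain_lift V hc hK0
    obtain ⟨h3, h4⟩ := hL u hu
    have h5 := hform (L u)
    rw [h3] at h5
    refine h5.trans ?_
    have h6 : ‖L u‖ₑ ^ 2 ≤ ENNReal.ofReal (3 * K ^ 2) * ‖u‖ₑ ^ 2 := by
      rw [← ofReal_norm, ← ofReal_norm, ← ENNReal.ofReal_pow (norm_nonneg _),
        ← ENNReal.ofReal_pow (norm_nonneg _), ← ENNReal.ofReal_mul (by positivity)]
      refine ENNReal.ofReal_le_ofReal (h4.trans ?_)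
      have : K₀ ^ 2 ≤ K ^ 2 := by gcongr
      have : 1 ≤ K ^ 2 := one_le_pow₀ (hK₀1.trans hKK)
      gcongr
      linarith
    calc _ ≤ ENNReal.ofReal (4 * ℓ * (a + b)) * (ENNReal.ofReal (3 * K ^ 2) * ‖u‖ₑ ^ 2) := by
          gcongr
      _ ≤ _ := by
          rw [← mul_assoc, ← ENNReal.ofReal_mul (by positivity)]
          refine mul_le_mul' (ENNReal.ofReal_le_ofReal ?_) le_rfl
          have : 0 ≤ ℓ * K ^ 2 := by positivity
          calc _ = 12 * (a + b) * (ℓ * K ^ 2) := by ring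
            _ ≤ (12 * (a + b) + 1) * (ℓ * K ^ 2) := by gcongr; linarith
            _ = _ := by ring
  · refine (hB u (lowEnergySpace_mono V c hKK hu) ρ _ hρ hform).trans ?_
    rw [h1]
    gcongr
    calc ENNReal.ofReal B * ENNReal.ofReal a + ENNReal.ofReal ε * ENNReal.ofReal (4 * ℓ * (a + b))
        ≤ ENNReal.ofReal |B| * ENNReal.ofReal a +
          ENNReal.ofReal ε * ENNReal.ofReal (4 * ℓ * (a + b)) := by
          gcongr; exact le_abs_self B
      _ = ENNReal.ofReal (|B| * a + ε * (4 * ℓ * (a + b))) := by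
          rw [← ENNReal.ofReal_mul (abs_nonneg _), ← ENNReal.ofReal_mul hε.le,
            ← ENNReal.ofReal_add (by positivity) (by positivity)]
      _ ≤ _ := by
          apply ENNReal.ofReal_le_ofReal
          have e1 : |B| * a ≤ ℓ * κ ^ 2 / 2 := by
            rw [div_le_iff₀ (by positivity)] at hNB
            linarith
          have e2 : ε * (4 * ℓ * (a + b)) ≤ ℓ * κ ^ 2 / 2 := by
            calc ε * (4 * ℓ * (a + b)) ≤ ε * (4 * ℓ * (a + b + 1)) := by
                  gcongr ε * (4 * ℓ * ?_)
                  linarith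
              _ = _ := by rw [hε_def]; field_simp; norm_num
          calc _ ≤ ℓ * κ ^ 2 := by linarith
            _ ≤ ℓ * K ^ 2 := by gcongr
            _ ≤ (12 * (a + b) + 1) * (ℓ * K ^ 2) :=
                le_mul_of_one_le_left (by positivity) (by linarith)
            _ = _ := by ring

/-! ### From one body to two bodies -/

/-- A two-body function whose sections lie in `S` inherits the quadratic form bounds of `S`. -/
theorem lintegral_mul_enorm_sq_le_of_sections {S : Submodule ℂ OneBody} {ρ : Plane × Plane → ℝ≥0∞}
    (hρ : AEMeasurable ρ) {M : ℝ≥0∞} (hM : M ≠ ⊤)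
    (hS : ∀ u ∈ S, ∀ z, ∫⁻ y, ρ (z, y) * ‖u y‖ₑ ^ 2 ≤ M * ‖u‖ₑ ^ 2)
    {Φ : TwoBody} (hΦ : ∀ᵐ x : Plane, ∃ u ∈ S, (fun y => Φ (x, y)) =ᵐ[volume] u) :
    ∫⁻ p, ρ p * ‖Φ p‖ₑ ^ 2 ≤ M * ‖Φ‖ₑ ^ 2 := by
  have hm : AEMeasurable (fun p => ‖Φ p‖ₑ ^ 2) (volume : Measure (Plane × Plane)) :=
    (Lp.aestronglyMeasurable Φ).enorm.pow_const 2
  have e1 : ∫⁻ p, ρ p * ‖Φ p‖ₑ ^ 2 = ∫⁻ x, ∫⁻ y, ρ (x, y) * ‖Φ (x, y)‖ₑ ^ 2 :=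
    lintegral_prod _ (hρ.mul hm)
  have e2 : ∫⁻ p, ‖Φ p‖ₑ ^ 2 = ∫⁻ x, ∫⁻ y, ‖Φ (x, y)‖ₑ ^ 2 := lintegral_prod _ hm
  rw [← lintegral_enorm_sq_eq_enorm_sq, e1, e2, ← lintegral_const_mul' _ _ hM]
  refine lintegral_mono_ae ?_
  filter_upwards [hΦ] with x ⟨u, hu, hx⟩
  have h := hS u hu x
  rw [← lintegral_enorm_sq_eq_enorm_sq] at h
  rw [lintegral_congr_ae (f := fun y => ρ (x, y) * ‖Φ (x, y)‖ₑ ^ 2)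
      (g := fun y => ρ (x, y) * ‖u y‖ₑ ^ 2)
      (hx.mono fun y hy => by simp only [hy]),
    lintegral_congr_ae (f := fun y => ‖Φ (x, y)‖ₑ ^ 2) (g := fun y => ‖u y‖ₑ ^ 2) (hx.mono fun y hy => by simp only [hy])]
  exact h

/-- The range of the tensor product of two orthogonal projections. -/
def tensorSpace (P Q : OneBody →L[ℂ] OneBody) : Submodule ℂ TwoBody :=
  (Submodule.span ℂ {Φ : TwoBody | ∃ f g : OneBody,
    Φ =ᵐ[volume] fun p => P f p.1 * Q g p.2}).topologicalClosure

theorem sections_mem_of_mem_span {P Q : OneBody →L[ℂ] OneBody} {S : Submodule ℂ OneBody}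
    (hQ : ∀ g, Q g ∈ S) {Φ : TwoBody} (hΦ : Φ ∈ Submodule.span ℂ {Φ : TwoBody | ∃ f g : OneBody,
      Φ =ᵐ[volume] fun p => P f p.1 * Q g p.2}) :
    ∀ᵐ x : Plane, ∃ u ∈ S, (fun y => Φ (x, y)) =ᵐ[volume] u := by
  induction hΦ using Submodule.span_induction with
  | mem Φ h =>
    obtain ⟨f, g, h⟩ := h
    filter_upwards [Measure.ae_ae_of_ae_prod h] with x hx
    refine ⟨P f x • Q g, S.smul_mem _ (hQ g), ?_⟩
    filter_upwards [hx, Lp.coeFn_smul (P f x) (Q g)] with y hy hy1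
    rw [hy, hy1]; rfl
  | zero =>
    filter_upwards [Measure.ae_ae_of_ae_prod (Lp.coeFn_zero ℂ 2 (volume : Measure (Plane × Plane)))]
      with x hx
    refine ⟨0, S.zero_mem, ?_⟩
    filter_upwards [hx, Lp.coeFn_zero ℂ 2 (volume : Measure Plane)] with y hy hy1
    rw [hy, hy1]; rfl
  | add Φ Θ _ _ h1 h2 =>
    filter_upwards [h1, h2, Measure.ae_ae_of_ae_prod (Lp.coeFn_add Φ Θ)]
      with x ⟨u, hu, hux⟩ ⟨v, hv, hvx⟩ hx
    refine ⟨u + v, S.add_mem hu hv, ?_⟩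
    filter_upwards [hx, hux, hvx, Lp.coeFn_add u v] with y hy hy1 hy2 hy3
    rw [hy, hy3, Pi.add_apply, Pi.add_apply, hy1, hy2]
  | smul a Φ _ h1 =>
    filter_upwards [h1, Measure.ae_ae_of_ae_prod (Lp.coeFn_smul a Φ)] with x ⟨u, hu, hux⟩ hx
    refine ⟨a • u, S.smul_mem a hu, ?_⟩
    filter_upwards [hx, hux, Lp.coeFn_smul a u] with y hy hy1 hy2
    rw [hy, hy2, Pi.smul_apply, Pi.smul_apply, hy1]

/-- Sections are controlled only on the algebraic span; Fatou carries the inequality itself to the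
closure, so `S` need not be closed. -/
theorem lintegral_mul_tensorSpace_le {P Q : OneBody →L[ℂ] OneBody} {S : Submodule ℂ OneBody}
    (hQ : ∀ g, Q g ∈ S) {ρ : Plane × Plane → ℝ≥0∞} (hρ : AEMeasurable ρ) {M : ℝ≥0∞} (hM : M ≠ ⊤)
    (hS : ∀ u ∈ S, ∀ z, ∫⁻ y, ρ (z, y) * ‖u y‖ₑ ^ 2 ≤ M * ‖u‖ₑ ^ 2)
    {Φ : TwoBody} (hΦ : Φ ∈ tensorSpace P Q) :
    ∫⁻ p, ρ p * ‖Φ p‖ₑ ^ 2 ≤ M * ‖Φ‖ₑ ^ 2 := by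
  obtain ⟨Θ, h1, h2⟩ := mem_closure_iff_seq_limit.1 hΦ
  exact lintegral_mul_enorm_sq_le_of_tendsto hρ h2 (m := fun n => M * ‖Θ n‖ₑ ^ 2)
    (ENNReal.Tendsto.const_mul (ENNReal.Tendsto.pow h2.enorm) (Or.inr hM))
    fun n => lintegral_mul_enorm_sq_le_of_sections hρ hM hS (sections_mem_of_mem_span hQ (h1 n))

theorem tensorProj_mem (P Q : OneBody →L[ℂ] OneBody) (Ψ : TwoBody) :
    tensorProj P Q Ψ ∈ tensorSpace P Q := by
  unfold tensorProj tensorSpace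
  exact Submodule.starProjection_apply_mem _ _

theorem re_inner_tensorProj (P Q : OneBody →L[ℂ] OneBody) (Ψ : TwoBody) :
    (inner ℂ Ψ (tensorProj P Q Ψ)).re = ‖tensorProj P Q Ψ‖ ^ 2 := by
  have h : inner ℂ (Ψ - tensorProj P Q Ψ) (tensorProj P Q Ψ) = 0 := by
    unfold tensorProj
    exact Submodule.starProjection_inner_eq_zero _ _ (Submodule.starProjection_apply_mem _ _)
  rw [inner_sub_left, sub_eq_zero] at h
  rw [h]
  exact inner_self_eq_norm_sq (𝕜 := ℂ) _

end

theorem mainTheorem3 :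
    ∃ C : ℝ → ℝ → ℝ, (∀ a b, 0 < C a b) ∧
      ∀ (w : Plane → ℝ), MemLp w 1 volume → MemLp w 2 volume → (∀ x, w (-x) = w x) →
      ∀ (β : ℝ), 0 < β →
      ∀ (V : Plane → ℝ) (s c : ℝ), LocallyIntegrable V volume → 0 < s → 0 < c →
        (∀ x, c⁻¹ * ‖x‖ ^ s - c ≤ V x) →
      ∀ κ : ℝ, 0 < κ →
      ∀ᶠ N : ℕ in atTop, ∀ K₁ K₂ : ℝ, κ ≤ K₂ → K₂ ≤ K₁ →
        ∀ Ψ : TwoBody,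
          Integrable (fun p : Plane × Plane => scaledPotential w β N (p.1 - p.2) *
            ‖tensorProj (lowEnergyProj V c K₁) (lowEnergyProj V c K₂) Ψ p‖ ^ 2) volume ∧
          -(C (eLpNorm w 1 volume).toReal (eLpNorm w 2 volume).toReal
              * β * K₁ * K₂ * Real.log N) *
              (inner ℂ Ψ (tensorProj (lowEnergyProj V c K₁) (lowEnergyProj V c K₂) Ψ)).re
            ≤ ∫ p : Plane × Plane, scaledPotential w β N (p.1 - p.2) *
                ‖tensorProj (lowEnergyProj V c K₁) (lowEnergyProj V c K₂) Ψ p‖ ^ 2 := by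
  -- Absolute values only secure positivity for all real arguments; the norms inserted later are
  -- nonnegative.
  refine ⟨fun a b => 12 * (|a| + |b|) + 1, fun a b => by positivity, ?_⟩
  intro w hw1 hw2 _ β hβ V s c _ hs hc hV κ hκ
  filter_upwards [eventually_lintegral_scaledPotential_le hw1 hw2 hβ hs hc hV hκ,
    eventually_gt_atTop 0] with N hN hN0 K₁ K₂ hK₂ hK₁ Ψ
  set a := (eLpNorm w 1 volume).toReal
  set b := (eLpNorm w 2 volume).toReal
  have ha : 0 ≤ a := ENNReal.toReal_nonneg
  have hb : 0 ≤ b := ENNReal.toReal_nonneg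
  have hlog : 0 ≤ Real.log N := Real.log_natCast_nonneg N
  have hK₂0 : 0 < K₂ := hκ.trans_le hK₂
  rw [re_inner_tensorProj]
  set Φ := tensorProj (lowEnergyProj V c K₁) (lowEnergyProj V c K₂) Ψ with hΦ
  have hwm : AEStronglyMeasurable (fun p : Plane × Plane => scaledPotential w β N (p.1 - p.2))
      volume :=
    (aestronglyMeasurable_scaledPotential hw1.1 β hN0).comp_quasiMeasurePreserving
      (quasiMeasurePreserving_sub_of_right_invariant volume volume)
  set m : ℝ := (12 * (a + b) + 1) * (β * K₂ ^ 2 * Real.log N)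
  have hm : 0 ≤ m := by positivity
  have hbound : ∫⁻ p : Plane × Plane, ‖scaledPotential w β N (p.1 - p.2)‖ₑ * ‖Φ p‖ₑ ^ 2 ≤
      ENNReal.ofReal m * ‖Φ‖ₑ ^ 2 :=
    lintegral_mul_tensorSpace_le (S := lowEnergySpace V c K₂)
      (ρ := fun p : Plane × Plane => ‖scaledPotential w β N (p.1 - p.2)‖ₑ)
      (lowEnergyProj_mem V c K₂) hwm.enorm ENNReal.ofReal_ne_top (hN K₂ hK₂) (tensorProj_mem _ _ Ψ)
  set F : Plane × Plane → ℝ := fun p => scaledPotential w β N (p.1 - p.2) * ‖Φ p‖ ^ 2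
  have hFm : AEStronglyMeasurable F volume :=
    hwm.mul ((Lp.aestronglyMeasurable Φ).norm.pow 2)
  have hF : ∫⁻ p, ‖F p‖ₑ ≤ ENNReal.ofReal (m * ‖Φ‖ ^ 2) := by
    rw [ENNReal.ofReal_mul hm, ENNReal.ofReal_pow (norm_nonneg _), ofReal_norm]
    refine le_trans (le_of_eq (lintegral_congr fun p => ?_)) hbound
    simp only [F]
    rw [enorm_mul, enorm_pow, enorm_norm]
  have hint : Integrable F volume := ⟨hFm, hF.trans_lt ENNReal.ofReal_lt_top⟩
  refine ⟨hint, ?_⟩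
  have h1 : ‖∫ p, F p‖ ≤ m * ‖Φ‖ ^ 2 := by
    rw [← ENNReal.ofReal_le_ofReal_iff (by positivity), ofReal_norm]
    exact (enorm_integral_le_lintegral_enorm _).trans hF
  have h2 : -(m * ‖Φ‖ ^ 2) ≤ ∫ p, F p := by
    rw [Real.norm_eq_abs] at h1
    exact (abs_le.1 h1).1
  refine le_trans ?_ h2
  rw [neg_mul, neg_le_neg_iff, abs_of_nonneg ha, abs_of_nonneg hb]
  -- The bound obtained from the second variable alone has `K₂ ^ 2`; the ordering `K₂ ≤ K₁` is used
  -- only here.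
  have h3 : (12 * (a + b) + 1) * β * Real.log N * (K₂ * K₂) ≤
      (12 * (a + b) + 1) * β * Real.log N * (K₁ * K₂) := by gcongr
  have h4 : m ≤ (12 * (a + b) + 1) * β * K₁ * K₂ * Real.log N := by
    simp only [m]; linarith
  gcongr
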